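/- For a set $X\subset\mathbb{R}^3$ let $A(X)=\{\,|P-Q| : P,Q\in X,\ P\neq Q\,\}$ be the set of Euclidean distances between distinct points of $X$, and call $X$ a $k$-distance set if $|A(X)|=k$. Theorem 1.4. Every $12$-point three-distance set $X\subset\mathbb{R}^3$ contains a five-point two-distance set; that is, if $|X|=12$ and $|A(X)|=3$, then there is a subset $Y\subseteq X$ with $|Y|=5$ and $|A(Y)|=2$. -/

import Mathlib

/-- The set `A(X)` of Euclidean distances between two distinct points of `X ⊆ ℝᵈ`. -/
def distanceSet {d : ℕ} (X : Set (EuclideanSpace ℝ (Fin d))) : Set ℝ :=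
  {r | ∃ P ∈ X, ∃ Q ∈ X, P ≠ Q ∧ dist P Q = r}

/-- `X ⊆ ℝᵈ` is a `k`-distance set if exactly `k` distances occur between distinct points of `X`
(`Set.encard` is used, so a set with infinitely many distances is not a `0`-distance set). -/
def IsKDistanceSet {d : ℕ} (k : ℕ) (X : Set (EuclideanSpace ℝ (Fin d))) : Prop :=
  (distanceSet X).encard = k

/-!
Let `D` be the largest distance in the three-distance set `X` and join two points of `X` by an edge
when their distance is `D`. Five points no two of which are joined form a set with at most two
distances, and with exactly two because `ℝ³` has no five equidistant points. So it is enough to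
find five pairwise non-adjacent vertices in this diameter graph, which has twelve vertices.

**Odd cycles.** The only geometric fact used about the diameter graph is Dol'nikov's theorem: two
odd cycles of the diameter graph of a set in `ℝ³` share a vertex
(`isBipartite_induce_or_of_disjoint`). Along an odd closed walk `p`, the directions `(-1) ^ i • (p
(i + 1) - p i)` form a polygon on the sphere that leads from a point to its antipode, and each of
its arcs consists of directions at a single vertex `x` of the walk, up to sign. For two disjoint
walks no arc meets an arc of the other polygon or its antipode (`smul_add_smul_ne_of_diameters`):
a common direction `w` at `x` and at `y`, or directions `w` at `x` and `-w` at `y`, contradict the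
maximality of `D` unless `x` and `y` are joined and `w` is the direction of this edge, and that is
impossible for disjoint walks. On the other hand, two such polygons have to meet up to sign
(`exists_smul_add_smul_eq_of_antiperiodic`). Otherwise let an axis run along the first polygon and
measure the total angle by which the second polygon turns around the axis. The angle is an odd
multiple of `π`, so it is constant; but it changes its sign as the axis is reversed.

**Combinatorics.** A graph on twelve vertices in which no two disjoint vertex sets both span odd
cycles has five independent vertices (`SimpleGraph.exists_indep_five_of_disjoint_isBipartite`).
Suppose not. If there is a triangle, then the other nine vertices span a bipartite graph, which
has an independent half. So there is none, neighbourhoods are independent, and all degrees are at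
most four. For non-adjacent `v` and `w`, the vertices far from both contain no independent triple,
so there are at most five of them since `R(3, 3) = 6`, and if there are five, they span an odd
cycle. When all degrees are at most three, this forces the graph to be cubic without cycles of
length less than six, and the six vertices at distance two from any vertex are independent. When
`v` has degree four, every vertex outside the closed neighbourhood of `v` has a neighbour among
those of `v`, so any two adjacent vertices of the remaining set `H` of seven vertices lie on a
five-cycle with `v` and two of its neighbours. Hence no edge in `H` is disjoint from a five-cycle
in `H`, which leaves only the possibility that `H` is a seven-cycle; each neighbour of `v` then
misses at least two of the seven independent triples of `H`, so two of the four neighbours miss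
the same triple.
-/

/-! ### Winding of a spherical polygon around an axis -/

section Winding

/-- The scalar triple product `x · (a × b)`. -/
def tripleProduct (x a b : EuclideanSpace ℝ (Fin 3)) : ℝ :=
  x 0 * (a 1 * b 2 - a 2 * b 1) + x 1 * (a 2 * b 0 - a 0 * b 2) + x 2 * (a 0 * b 1 - a 1 * b 0)

/-- The complex number whose argument is the oriented angle from `a` to `b` around the axis `x`. If
`α` and `β` are the complex coordinates of the projections of `a` and `b` to the plane orthogonal
to `x`, it equals `‖x‖ ^ 2 * conj α * β`; the formula avoids the choice of a frame of the plane. -/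
noncomputable def axialProduct (x a b : EuclideanSpace ℝ (Fin 3)) : ℂ :=
  ⟨inner ℝ x x * inner ℝ a b - inner ℝ x a * inner ℝ x b, ‖x‖ * tripleProduct x a b⟩

theorem inner_eq_sum_three (a b : EuclideanSpace ℝ (Fin 3)) :
    inner ℝ a b = a 0 * b 0 + a 1 * b 1 + a 2 * b 2 := by
  simp [PiLp.inner_apply, Fin.sum_univ_three, mul_comm]

theorem axialProduct_mul (x a b c : EuclideanSpace ℝ (Fin 3)) :
    axialProduct x a b * axialProduct x b c =
      ((inner ℝ x x * inner ℝ b b - inner ℝ x b * inner ℝ x b : ℝ) : ℂ) * axialProduct x a c := by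
  have hx : ‖x‖ * ‖x‖ = x 0 * x 0 + x 1 * x 1 + x 2 * x 2 := by
    rw [← real_inner_self_eq_norm_mul_norm, inner_eq_sum_three]
  apply Complex.ext
  · simp only [axialProduct, tripleProduct, inner_eq_sum_three, Complex.mul_re, Complex.ofReal_re,
      Complex.ofReal_im]
    linear_combination (-(x 0 * (a 1 * b 2 - a 2 * b 1) + x 1 * (a 2 * b 0 - a 0 * b 2) +
      x 2 * (a 0 * b 1 - a 1 * b 0)) * (x 0 * (b 1 * c 2 - b 2 * c 1) +
      x 1 * (b 2 * c 0 - b 0 * c 2) + x 2 * (b 0 * c 1 - b 1 * c 0))) * hx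
  · simp only [axialProduct, tripleProduct, inner_eq_sum_three, Complex.mul_im, Complex.ofReal_re,
      Complex.ofReal_im]
    ring

theorem axialProduct_self_right (x a : EuclideanSpace ℝ (Fin 3)) :
    axialProduct x a a =
      ((inner ℝ x x * inner ℝ a a - inner ℝ x a * inner ℝ x a : ℝ) : ℂ) := by
  apply Complex.ext
  · rw [Complex.ofReal_re]; rfl
  · simp only [axialProduct, tripleProduct, Complex.ofReal_im]
    ring

theorem axialProduct_neg_right (x a b : EuclideanSpace ℝ (Fin 3)) :
    axialProduct x a (-b) = -axialProduct x a b := by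
  apply Complex.ext
  · simp [axialProduct]; ring
  · simp [axialProduct, tripleProduct]; ring

theorem axialProduct_neg_left (x a b : EuclideanSpace ℝ (Fin 3)) :
    axialProduct (-x) a b = (starRingEnd ℂ) (axialProduct x a b) := by
  apply Complex.ext
  · simp [axialProduct]
  · simp [axialProduct, tripleProduct]; ring

theorem continuous_axialProduct (a b : EuclideanSpace ℝ (Fin 3)) :
    Continuous fun x => axialProduct x a b := by
  have : (fun x => axialProduct x a b) = fun x =>
      ((inner ℝ x x * inner ℝ a b - inner ℝ x a * inner ℝ x b : ℝ) : ℂ) +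
        ((‖x‖ * tripleProduct x a b : ℝ) : ℂ) * Complex.I := by
    funext x
    apply Complex.ext
    · rw [Complex.add_re, Complex.re_ofReal_mul, Complex.I_re, mul_zero, add_zero,
        Complex.ofReal_re]; rfl
    · rw [Complex.add_im, Complex.im_ofReal_mul, Complex.I_im, mul_one, Complex.ofReal_im,
        zero_add]; rfl
  rw [this]
  unfold tripleProduct
  fun_prop

/-- If `a` lies on the axis `x`, then all products with `a` vanish. The expression is
`‖x‖ ^ 2` times the squared distance of `a` from the axis. -/
theorem gram_pos_of_axialProduct_ne_zero {x a b : EuclideanSpace ℝ (Fin 3)}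
    (h : axialProduct x a b ≠ 0) :
    0 < inner ℝ x x * inner ℝ a a - inner ℝ x a * inner ℝ x a := by
  have hcs := real_inner_mul_inner_self_le x a
  refine lt_of_le_of_ne (by linarith) fun h0 => h ?_
  have h1 := axialProduct_mul x b a b
  have h2 : axialProduct x b a = (starRingEnd ℂ) (axialProduct x a b) := by
    apply Complex.ext
    · simp [axialProduct, real_inner_comm, mul_comm]
    · simp only [axialProduct, tripleProduct, Complex.conj_im]; ring
  rw [← h0, h2, Complex.ofReal_zero, zero_mul, mul_eq_zero] at h1
  simpa using h1

/-- The angle from `a` to `b` around `x` is neither undefined nor `π` if the cone spanned by `a` and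
`b` does not meet the line spanned by `x`. -/
theorem axialProduct_mem_slitPlane {x a b : EuclideanSpace ℝ (Fin 3)} (hx : x ≠ 0)
    (h : ∀ γ δ t : ℝ, 0 ≤ γ → 0 ≤ δ → 0 < γ + δ → γ • a + δ • b ≠ t • x) :
    axialProduct x a b ∈ Complex.slitPlane := by
  rw [Complex.mem_slitPlane_iff]
  by_contra! hcon
  obtain ⟨hre, him⟩ := hcon
  set r := inner ℝ x x with hr
  have hr0 : 0 < r := real_inner_self_pos.2 hx
  set A := r * inner ℝ a a - inner ℝ x a * inner ℝ x a with hA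
  set B := r * inner ℝ b b - inner ℝ x b * inner ℝ x b with hB
  set C := r * inner ℝ a b - inner ℝ x a * inner ℝ x b with hC
  have hC' : (axialProduct x a b).re = C := rfl
  have hA0 : 0 ≤ A := by have := real_inner_mul_inner_self_le x a; simp only [hA, hr]; linarith
  have hB0 : 0 ≤ B := by have := real_inner_mul_inner_self_le x b; simp only [hB, hr]; linarith
  have hab : C ^ 2 = A * B := by
    have h1 := congrArg Complex.re (axialProduct_mul x a b a)
    have h2 : (axialProduct x b a).re = C := by
      simp only [axialProduct, hC, hr]; rw [real_inner_comm a b]; ring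
    rw [axialProduct_self_right, ← Complex.ofReal_mul, Complex.ofReal_re, Complex.mul_re, him,
      hC', h2] at h1
    linear_combination h1
  -- `γ a + δ b` is parallel to `x` as soon as its component orthogonal to `x` vanishes
  have key : ∀ γ δ : ℝ, 0 ≤ γ → 0 ≤ δ → 0 < γ + δ →
      γ ^ 2 * A + δ ^ 2 * B + 2 * γ * δ * C ≠ 0 := by
    intro γ δ h1 h2 h3 h0
    set w := γ • a + δ • b with hw
    have hz : r • w - (inner ℝ x w) • x = 0 := by
      rw [← inner_self_eq_zero (𝕜 := ℝ)]
      have : inner ℝ (r • w - (inner ℝ x w) • x) (r • w - (inner ℝ x w) • x) =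
          r * (r * inner ℝ w w - inner ℝ x w * inner ℝ x w) := by
        simp only [inner_sub_left, inner_sub_right, inner_smul_left, inner_smul_right,
          RCLike.conj_to_real, real_inner_comm x w, ← hr]
        ring
      rw [this]
      have : r * inner ℝ w w - inner ℝ x w * inner ℝ x w =
          γ ^ 2 * A + δ ^ 2 * B + 2 * γ * δ * C := by
        simp only [hw, hA, hB, hC, inner_add_left, inner_add_right, inner_smul_left,
          inner_smul_right, RCLike.conj_to_real, real_inner_comm a b]
        ring
      rw [this, h0, mul_zero]
    refine h γ δ (r⁻¹ * inner ℝ x w) h1 h2 h3 ?_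
    rw [mul_smul, ← sub_eq_zero.1 hz, smul_smul, inv_mul_cancel₀ hr0.ne', one_smul]
  rcases hA0.eq_or_lt with h0 | h0
  · exact key 1 0 zero_le_one le_rfl (by norm_num) (by simp [← h0])
  · refine key (√B) (√A) (Real.sqrt_nonneg _) (Real.sqrt_nonneg _) ?_ ?_
    · have := Real.sqrt_pos.2 h0
      have := Real.sqrt_nonneg B
      linarith
    · have h4 : C = -(√A * √B) := by
        rw [← Real.sqrt_mul hA0, ← hab, Real.sqrt_sq_eq_abs, abs_of_nonpos (hC' ▸ hre), neg_neg]
      rw [Real.sq_sqrt hA0, Real.sq_sqrt hB0, h4]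
      have h5 := Real.mul_self_sqrt hA0
      have h6 := Real.mul_self_sqrt hB0
      linear_combination (-2 * √B * √B) * h5 - 2 * A * h6

/-- The total angle, in radians, by which the polygon `v 0, …, v m` turns around the axis `x`. -/
noncomputable def axialWinding (v : ℕ → EuclideanSpace ℝ (Fin 3)) (m : ℕ)
    (x : EuclideanSpace ℝ (Fin 3)) : ℝ :=
  ∑ j ∈ Finset.range m, (axialProduct x (v j) (v (j + 1))).arg

theorem axialWinding_neg {v : ℕ → EuclideanSpace ℝ (Fin 3)} {m : ℕ}
    {x : EuclideanSpace ℝ (Fin 3)}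
    (h : ∀ j, axialProduct x (v j) (v (j + 1)) ∈ Complex.slitPlane) :
    axialWinding v m (-x) = -axialWinding v m x := by
  unfold axialWinding
  rw [← Finset.sum_neg_distrib]
  refine Finset.sum_congr rfl fun j _ => ?_
  rw [axialProduct_neg_left, Complex.arg_conj, if_neg (Complex.slitPlane_arg_ne_pi (h j))]

theorem exists_prod_axialProduct_eq {v : ℕ → EuclideanSpace ℝ (Fin 3)}
    {x : EuclideanSpace ℝ (Fin 3)} (h : ∀ j, axialProduct x (v j) (v (j + 1)) ≠ 0) (k : ℕ) :
    ∃ ρ : ℝ, 0 < ρ ∧ ∏ j ∈ Finset.range k, axialProduct x (v j) (v (j + 1)) =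
      (ρ : ℂ) * axialProduct x (v 0) (v k) := by
  induction k with
  | zero =>
    have h0 := gram_pos_of_axialProduct_ne_zero (h 0)
    refine ⟨_, inv_pos.2 h0, ?_⟩
    rw [axialProduct_self_right, ← Complex.ofReal_mul, inv_mul_cancel₀ h0.ne']
    simp
  | succ k ih =>
    obtain ⟨ρ, hρ, ih⟩ := ih
    refine ⟨_, mul_pos hρ (gram_pos_of_axialProduct_ne_zero (h k)), ?_⟩
    rw [Finset.prod_range_succ, ih, mul_assoc, axialProduct_mul, Complex.ofReal_mul, mul_assoc]

/-- A polygon from a point to its antipode turns around any axis by an odd multiple of `π`. -/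
theorem exp_axialWinding {v : ℕ → EuclideanSpace ℝ (Fin 3)} {m : ℕ} (hv : v m = -v 0)
    {x : EuclideanSpace ℝ (Fin 3)} (h : ∀ j, axialProduct x (v j) (v (j + 1)) ≠ 0) :
    Complex.exp (axialWinding v m x * Complex.I) = -1 := by
  obtain ⟨ρ, hρ, hprod⟩ := exists_prod_axialProduct_eq h m
  have h0 := gram_pos_of_axialProduct_ne_zero (h 0)
  rw [hv, axialProduct_neg_right, axialProduct_self_right] at hprod
  have h1 : ∏ j ∈ Finset.range m, axialProduct x (v j) (v (j + 1)) =
      ((∏ j ∈ Finset.range m, ‖axialProduct x (v j) (v (j + 1))‖ : ℝ) : ℂ) *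
        Complex.exp (axialWinding v m x * Complex.I) := by
    rw [axialWinding, Complex.ofReal_sum, Finset.sum_mul, Complex.exp_sum, Complex.ofReal_prod,
      ← Finset.prod_mul_distrib]
    exact Finset.prod_congr rfl fun j _ => (Complex.norm_mul_exp_arg_mul_I _).symm
  set P := ∏ j ∈ Finset.range m, ‖axialProduct x (v j) (v (j + 1))‖ with hP
  have hP0 : 0 < P := Finset.prod_pos fun j _ => norm_pos_iff.2 (h j)
  set g := inner ℝ x x * inner ℝ (v 0) (v 0) - inner ℝ x (v 0) * inner ℝ x (v 0)
  have h2 : (P : ℂ) * Complex.exp (axialWinding v m x * Complex.I) = -((ρ * g : ℝ) : ℂ) := by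
    rw [← h1, hprod]; push_cast; ring
  have h3 : P = ρ * g := by
    have := congrArg norm h2
    rwa [norm_mul, Complex.norm_exp_ofReal_mul_I, norm_neg, Complex.norm_real, Complex.norm_real,
      mul_one, Real.norm_of_nonneg hP0.le, Real.norm_of_nonneg (mul_pos hρ h0).le] at this
  rw [← h3] at h2
  have h4 : (P : ℂ) ≠ 0 := by exact_mod_cast hP0.ne'
  apply mul_left_cancel₀ h4
  rw [h2]; ring

/-- The total angle does not change as the axis moves along a segment that the polygon avoids, being
continuous with values in the odd multiples of `π`. -/
theorem axialWinding_eq_of_segment {v : ℕ → EuclideanSpace ℝ (Fin 3)} {m : ℕ} (hv : v m = -v 0)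
    {a b : EuclideanSpace ℝ (Fin 3)}
    (h : ∀ x ∈ segment ℝ a b, ∀ j, axialProduct x (v j) (v (j + 1)) ∈ Complex.slitPlane) :
    axialWinding v m a = axialWinding v m b := by
  set f : EuclideanSpace ℝ (Fin 3) → ℝ := fun x => (axialWinding v m x - Real.pi) / (2 * Real.pi)
    with hf
  have hpi := Real.pi_pos
  have hcont : ContinuousOn f (segment ℝ a b) := by
    refine ContinuousOn.div_const (ContinuousOn.sub ?_ continuousOn_const) _
    refine continuousOn_finsetSum _ fun j _ x hx => ?_
    exact ((Complex.continuousAt_arg (h x hx j)).comp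
      (f := fun x => axialProduct x (v j) (v (j + 1)))
      (continuous_axialProduct _ _).continuousAt).continuousWithinAt
  have hmaps : Set.MapsTo f (segment ℝ a b) (Set.range ((↑) : ℤ → ℝ)) := by
    intro x hx
    have h1 := exp_axialWinding hv fun j => Complex.slitPlane_ne_zero (h x hx j)
    rw [← Complex.exp_pi_mul_I, Complex.exp_eq_exp_iff_exists_int] at h1
    obtain ⟨k, hk⟩ := h1
    refine ⟨k, ?_⟩
    have h2 : ((axialWinding v m x : ℝ) : ℂ) = ((Real.pi + k * (2 * Real.pi) : ℝ) : ℂ) := by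
      apply mul_right_cancel₀ Complex.I_ne_zero
      rw [hk]; push_cast; ring
    have h3 := Complex.ofReal_injective h2
    simp only [hf, h3]
    field_simp
    ring
  have hdisc : DiscreteTopology (Set.range ((↑) : ℤ → ℝ)) :=
    (Int.isClosedEmbedding_coe_real.isEmbedding.toHomeomorph).symm.isEmbedding.discreteTopology
  have h1 := (convex_segment a b).isPreconnected.constant_of_mapsTo ⟨hdisc⟩ hcont hmaps
    (left_mem_segment ℝ a b) (right_mem_segment ℝ a b)
  simp only [hf] at h1
  field_simp at h1
  linarith

/-- Two polygons on the sphere, each leading from a point to its antipode, meet up to sign. Points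
of the sphere are given by non-zero vectors, and arcs by segments. -/
theorem exists_smul_add_smul_eq_of_antiperiodic {u v : ℕ → EuclideanSpace ℝ (Fin 3)} {n m : ℕ}
    (hu : u n = -u 0) (hv : v m = -v 0)
    (h0 : ∀ i, ∀ x ∈ segment ℝ (u i) (u (i + 1)), x ≠ 0) :
    ∃ i j, ∃ x ∈ segment ℝ (u i) (u (i + 1)), ∃ γ δ t : ℝ, 0 ≤ γ ∧ 0 ≤ δ ∧ 0 < γ + δ ∧
      γ • v j + δ • v (j + 1) = t • x := by
  by_contra! hcon
  have hs : ∀ i, ∀ x ∈ segment ℝ (u i) (u (i + 1)), ∀ j,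
      axialProduct x (v j) (v (j + 1)) ∈ Complex.slitPlane := fun i x hx j =>
    axialProduct_mem_slitPlane (h0 i x hx) (hcon i j x hx)
  have hconst : ∀ k, axialWinding v m (u 0) = axialWinding v m (u k) := by
    intro k
    induction k with
    | zero => rfl
    | succ k ih => rw [ih, axialWinding_eq_of_segment hv (hs k)]
  have hs0 := hs 0 (u 0) (left_mem_segment ℝ _ _)
  have h1 := hconst n
  rw [hu, axialWinding_neg hs0] at h1
  have h2 := exp_axialWinding (m := m) hv fun j => Complex.slitPlane_ne_zero (hs0 j)
  rw [show axialWinding v m (u 0) = 0 by linarith] at h2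
  norm_num at h2

end Winding

/-! ### Odd cycles in diameter graphs -/

section Diameters

variable {F : Type*} [NormedAddCommGroup F] [InnerProductSpace ℝ F]

/-- If `a` and `b` have length `D` and translation by `q` keeps them in the ball of radius `D`, then
the same holds, in a quantitative form, for the vectors of length `D` in the cone they span. -/
theorem add_mul_norm_sq_add_two_mul_inner_nonpos {D : ℝ} {a b q : F} (ha : ‖a‖ = D) (hb : ‖b‖ = D)
    (hqa : ‖q + a‖ ≤ D) (hqb : ‖q + b‖ ≤ D) {α β : ℝ} (hα : 0 ≤ α) (hβ : 0 ≤ β) :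
    (α + β) * ‖q‖ ^ 2 + 2 * inner ℝ q (α • a + β • b) ≤ 0 := by
  have h1 : ‖q + a‖ ^ 2 ≤ D ^ 2 := pow_le_pow_left₀ (norm_nonneg _) hqa 2
  have h2 : ‖q + b‖ ^ 2 ≤ D ^ 2 := pow_le_pow_left₀ (norm_nonneg _) hqb 2
  rw [norm_add_sq_real, ha] at h1
  rw [norm_add_sq_real, hb] at h2
  rw [inner_add_right, inner_smul_right, inner_smul_right]
  nlinarith [mul_nonneg hα (sub_nonneg.2 h1), mul_nonneg hβ (sub_nonneg.2 h2)]

theorem norm_smul_add_smul_sq (a b : F) (α β : ℝ) :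
    ‖α • a + β • b‖ ^ 2 = α ^ 2 * ‖a‖ ^ 2 + β ^ 2 * ‖b‖ ^ 2 + 2 * α * β * inner ℝ a b := by
  rw [norm_add_sq_real, norm_smul, norm_smul, inner_smul_left, inner_smul_right, mul_pow, mul_pow,
    Real.norm_eq_abs, Real.norm_eq_abs, sq_abs, sq_abs, RCLike.conj_to_real]
  ring

theorem one_le_add_of_norm_smul_add_smul_eq {D : ℝ} (hD : 0 < D) {a b : F} (ha : ‖a‖ = D)
    (hb : ‖b‖ = D) {α β : ℝ} (hα : 0 ≤ α) (hβ : 0 ≤ β) (hw : ‖α • a + β • b‖ = D) :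
    1 ≤ α + β := by
  have h := norm_add_le (α • a) (β • b)
  rw [hw, norm_smul, norm_smul, ha, hb, Real.norm_of_nonneg hα, Real.norm_of_nonneg hβ] at h
  nlinarith

theorem smul_add_smul_ne_zero {D : ℝ} (hD : 0 < D) {a b : F} (ha : ‖a‖ = D)
    (hb : ‖b‖ = D) (hab : ‖a - b‖ ≤ D) {α β : ℝ} (hα : 0 ≤ α) (hβ : 0 ≤ β) (h : 0 < α + β) :
    α • a + β • b ≠ 0 := by
  intro h0
  have h1 := norm_smul_add_smul_sq a b α β
  have h2 : ‖a - b‖ ^ 2 ≤ D ^ 2 := pow_le_pow_left₀ (norm_nonneg _) hab 2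
  rw [norm_sub_sq_real, ha, hb] at h2
  rw [h0, norm_zero, ha, hb] at h1
  have h3 : 0 ≤ inner ℝ a b := by nlinarith
  have h4 := mul_nonneg (mul_nonneg hα hβ) h3
  have h5 : 0 < (α ^ 2 + β ^ 2) * D ^ 2 := by
    have : 0 < α ^ 2 + β ^ 2 := by nlinarith [sq_nonneg (α - β)]
    positivity
  nlinarith

/-- Let `a - x` and `b - x`, `c - y` and `d - y` be edges of the diameter graph. If the cone of
directions at `x` contains the opposite `w` of a direction at `y`, then the points `x + w` and
`y - w` could be added to the set without increasing its diameter, and this forces `y = x + w`. For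
`w` inside the cone, all points but `x` would be at distance less than `D` from `y`. -/
theorem eq_or_eq_of_neg_eq {D : ℝ} (hD : 0 < D) {x a b y c d : F}
    (hxa : ‖a - x‖ = D) (hxb : ‖b - x‖ = D) (hyc : ‖c - y‖ = D) (hyd : ‖d - y‖ = D)
    (hxy : ‖x - y‖ ≤ D) (hac : ‖a - c‖ ≤ D) (had : ‖a - d‖ ≤ D) (hbc : ‖b - c‖ ≤ D)
    (hbd : ‖b - d‖ ≤ D) {α β γ δ : ℝ} (hα : 0 ≤ α) (hβ : 0 ≤ β) (hγ : 0 ≤ γ)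
    (hδ : 0 ≤ δ) (hw : ‖α • (a - x) + β • (b - x)‖ = D)
    (h : γ • (c - y) + δ • (d - y) = -(α • (a - x) + β • (b - x))) :
    x = c ∨ y = a ∨ y = b := by
  set w := α • (a - x) + β • (b - x) with hwdef
  have hw' : ‖γ • (c - y) + δ • (d - y)‖ = D := by rw [h, norm_neg, hw]
  have hαβ := one_le_add_of_norm_smul_add_smul_eq hD hxa hxb hα hβ hw
  have hγδ := one_le_add_of_norm_smul_add_smul_eq hD hyc hyd hγ hδ hw'
  -- the point `x + w` is within distance `D` of every `z` for which `a` and `b` are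
  have key : ∀ z : F, ‖a - z‖ ≤ D → ‖b - z‖ ≤ D →
      ‖x + w - z‖ ^ 2 ≤ D ^ 2 - (α + β - 1) * ‖x - z‖ ^ 2 := by
    intro z hza hzb
    have h1 := add_mul_norm_sq_add_two_mul_inner_nonpos (q := x - z) hxa hxb
      (by rwa [show x - z + (a - x) = a - z by abel])
      (by rwa [show x - z + (b - x) = b - z by abel]) hα hβ
    rw [← hwdef] at h1
    rw [show x + w - z = (x - z) + w by abel, norm_add_sq_real, hw]
    linarith
  have key' : ∀ z : F, ‖a - z‖ ≤ D → ‖b - z‖ ≤ D → ‖x + w - z‖ ≤ D := by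
    intro z hza hzb
    refine le_of_sq_le_sq ?_ hD.le
    have := key z hza hzb
    nlinarith [mul_nonneg (sub_nonneg.2 hαβ) (sq_nonneg ‖x - z‖)]
  have hpc := key' c hac hbc
  have hpd := key' d had hbd
  -- so it may be added to the point set, and then `y - w` is within distance `D` of it
  have hpp : ‖(x - y) + 2 • w‖ ^ 2 ≤ D ^ 2 := by
    have h1 := add_mul_norm_sq_add_two_mul_inner_nonpos (q := y - (x + w)) hyc hyd
      (by rwa [show y - (x + w) + (c - y) = -(x + w - c) by abel, norm_neg])
      (by rwa [show y - (x + w) + (d - y) = -(x + w - d) by abel, norm_neg]) hγ hδ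
    rw [h] at h1
    rw [show (x - y) + 2 • w = -(y - (x + w) + -w) by rw [two_smul]; abel, norm_neg,
      norm_add_sq_real, norm_neg, hw]
    nlinarith [mul_nonneg (sub_nonneg.2 hγδ) (sq_nonneg ‖y - (x + w)‖)]
  have hyw : y = x + w := by
    have h1 : ‖x - y‖ ^ 2 ≤ D ^ 2 := pow_le_pow_left₀ (norm_nonneg _) hxy 2
    have h2 := parallelogram_law_with_norm ℝ (x - y + w) w
    rw [show x - y + w + w = x - y + 2 • w by rw [two_smul]; abel, add_sub_cancel_right, hw] at h2
    have h3 : ‖x - y + w‖ = 0 := by nlinarith [norm_nonneg (x - y + w)]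
    rw [norm_eq_zero] at h3
    rw [← sub_eq_zero, ← neg_eq_zero, ← h3]; abel
  by_cases hxc' : x = c
  · exact Or.inl hxc'
  right
  have h1 := key c hac hbc
  rw [← hyw, norm_sub_rev, hyc] at h1
  have h2 : 0 < ‖x - c‖ ^ 2 := by
    have := norm_pos_iff.2 (sub_ne_zero.2 hxc')
    positivity
  have h3 : β = 1 - α := by nlinarith
  have h4 := norm_smul_add_smul_sq (a - x) (b - x) α β
  rw [← hwdef, hw, hxa, hxb, h3] at h4
  have h5 := norm_sub_sq_real (a - x) (b - x)
  rw [hxa, hxb, sub_sub_sub_cancel_right] at h5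
  have h6 : α * ((1 - α) * ‖a - b‖ ^ 2) = 0 := by rw [h5]; linear_combination h4
  rcases mul_eq_zero.1 h6 with h7 | h7
  · right; rw [hyw, hwdef, h3, h7]; simp
  rcases mul_eq_zero.1 h7 with h8 | h8
  · left; rw [hyw, hwdef, h3, h8, show α = 1 by linarith]; simp
  · have h9 : a = b := by
      rw [← sub_eq_zero, ← norm_eq_zero]; exact pow_eq_zero_iff two_ne_zero |>.1 h8
    left; rw [hyw, hwdef, h3, ← h9, ← add_smul]; simp

/-- In a set of diameter `D`, let `xa`, `xb` and `yc`, `yd` be edges of length `D`. If `y` is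
none of `x`, `a`, `b` and `x ≠ c`, then the cones of directions spanned by the edges at `x` and at
`y` meet only in `0`, even up to sign. -/
theorem smul_add_smul_ne_of_diameters {D : ℝ} (hD : 0 < D) {S : Set F}
    (hS : ∀ p ∈ S, ∀ q ∈ S, ‖p - q‖ ≤ D) {x a b y c d : F} (hx : x ∈ S) (ha : a ∈ S) (hb : b ∈ S)
    (hy : y ∈ S) (hc : c ∈ S) (hd : d ∈ S)
    (hxa : ‖a - x‖ = D) (hxb : ‖b - x‖ = D) (hyc : ‖c - y‖ = D) (hyd : ‖d - y‖ = D)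
    (hxy : x ≠ y) (hxc : x ≠ c) (hya : y ≠ a) (hyb : y ≠ b) {α β γ δ : ℝ} (hα : 0 ≤ α)
    (hβ : 0 ≤ β) (hαβ : 0 < α + β) (hγ : 0 ≤ γ) (hδ : 0 ≤ δ) (hγδ : 0 < γ + δ) (t : ℝ) :
    γ • (c - y) + δ • (d - y) ≠ t • (α • (a - x) + β • (b - x)) := by
  intro h
  set w := α • (a - x) + β • (b - x) with hw
  have hw0 : w ≠ 0 := smul_add_smul_ne_zero hD hxa hxb
    (by rw [sub_sub_sub_cancel_right]; exact hS a ha b hb) hα hβ hαβ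
  have hw0' : γ • (c - y) + δ • (d - y) ≠ 0 := smul_add_smul_ne_zero hD hyc hyd
    (by rw [sub_sub_sub_cancel_right]; exact hS c hc d hd) hγ hδ hγδ
  rcases lt_trichotomy t 0 with ht | ht | ht
  -- opposite directions: rescale both vectors to length `D`
  · set s := D / ‖w‖ with hs
    have hwpos := norm_pos_iff.2 hw0
    have hs0 : 0 < s := div_pos hD hwpos
    have hs1 : 0 < s / -t := div_pos hs0 (neg_pos.2 ht)
    have := eq_or_eq_of_neg_eq hD hxa hxb hyc hyd (hS x hx y hy) (hS a ha c hc) (hS a ha d hd)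
      (hS b hb c hc) (hS b hb d hd)
      (mul_nonneg hs0.le hα) (mul_nonneg hs0.le hβ) (mul_nonneg hs1.le hγ) (mul_nonneg hs1.le hδ)
      (by
        rw [mul_smul, mul_smul, ← smul_add, ← hw, norm_smul, Real.norm_of_nonneg hs0.le, hs,
          div_mul_cancel₀ _ hwpos.ne'])
      (by
        rw [mul_smul, mul_smul, ← smul_add, h, mul_smul, mul_smul, ← smul_add, ← hw, smul_smul,
          ← neg_smul]
        congr 1
        field_simp [ht.ne])
    tauto
  · exact hw0' (by rw [h, ht, zero_smul])
  · have h1 := add_mul_norm_sq_add_two_mul_inner_nonpos (q := x - y) hxa hxb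
      (by rw [show x - y + (a - x) = a - y by abel]; exact hS a ha y hy)
      (by rw [show x - y + (b - x) = b - y by abel]; exact hS b hb y hy) hα hβ
    have h2 := add_mul_norm_sq_add_two_mul_inner_nonpos (q := y - x) hyc hyd
      (by rw [show y - x + (c - y) = c - x by abel]; exact hS c hc x hx)
      (by rw [show y - x + (d - y) = d - x by abel]; exact hS d hd x hx) hγ hδ
    rw [h, ← neg_sub x y, norm_neg, inner_neg_left, inner_smul_right] at h2
    rw [← hw] at h1
    have h3 : 0 < ‖x - y‖ ^ 2 := by
      have := norm_pos_iff.2 (sub_ne_zero.2 hxy)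
      positivity
    nlinarith [mul_pos hαβ h3, mul_pos hγδ h3, mul_nonneg ht.le (neg_nonneg.2 h1)]

end Diameters

section OddCycles

/-- A set of vertices that does not span a bipartite graph carries an odd closed walk, here written
as a periodic sequence. -/
theorem SimpleGraph.exists_periodic_of_not_isBipartite_induce {V : Type*} {G : SimpleGraph V}
    {S : Set V} (h : ¬ (G.induce S).IsBipartite) :
    ∃ (n : ℕ) (p : ℕ → V), Odd n ∧ (∀ i, p i ∈ S) ∧ (∀ i, G.Adj (p i) (p (i + 1))) ∧
      ∀ i, p (i + n) = p i := by
  rw [SimpleGraph.IsBipartite, SimpleGraph.two_colorable_iff_forall_loop_even] at h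
  push Not at h
  obtain ⟨u, w, hw⟩ := h
  have hn : 0 < w.length := (Nat.not_even_iff_odd.1 hw).pos
  refine ⟨w.length, fun i => w.getVert (i % w.length), Nat.not_even_iff_odd.1 hw,
    fun i => Subtype.coe_prop _, fun i => ?_, fun i => by simp⟩
  have h1 : (G.induce S).Adj (w.getVert (i % w.length)) (w.getVert (i % w.length + 1)) :=
    w.adj_getVert_succ (Nat.mod_lt _ hn)
  have h2 : w.getVert (i % w.length + 1) = w.getVert ((i + 1) % w.length) := by
    rcases (Nat.succ_le_of_lt (Nat.mod_lt i hn)).eq_or_lt with h3 | h3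
    · have h4 : (i + 1) % w.length = 0 := by
        rw [Nat.add_mod, ← Nat.mod_add_mod, Nat.mod_mod, Nat.add_mod_mod]
        rw [show i % w.length + 1 = w.length from h3, Nat.mod_self]
      rw [h4, show i % w.length + 1 = w.length from h3, SimpleGraph.Walk.getVert_length,
        SimpleGraph.Walk.getVert_zero]
    · rw [← Nat.mod_add_mod i, Nat.mod_eq_of_lt h3]
  rw [h2] at h1
  exact h1

/-- **Dol'nikov's theorem**: two odd cycles in the diameter graph of a set in `ℝ³` share a
vertex. -/
theorem isBipartite_induce_or_of_disjoint {V : Type*} {G : SimpleGraph V}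
    {f : V → EuclideanSpace ℝ (Fin 3)} (hf : Function.Injective f) {D : ℝ} (hD : 0 < D)
    (hle : ∀ a b, dist (f a) (f b) ≤ D) (hG : ∀ a b, G.Adj a b → dist (f a) (f b) = D)
    {S T : Set V} (hST : Disjoint S T) :
    (G.induce S).IsBipartite ∨ (G.induce T).IsBipartite := by
  by_contra! hcon
  obtain ⟨n, p, hn, hpS, hp, hpn⟩ := SimpleGraph.exists_periodic_of_not_isBipartite_induce hcon.1
  obtain ⟨m, q, hm, hqT, hq, hqm⟩ := SimpleGraph.exists_periodic_of_not_isBipartite_induce hcon.2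
  have hne : ∀ i j, f (p i) ≠ f (q j) := fun i j h =>
    Set.disjoint_left.1 hST (hpS i) (hf h ▸ hqT j)
  have hdiam : ∀ a ∈ Set.range f, ∀ b ∈ Set.range f, ‖a - b‖ ≤ D := by
    rintro _ ⟨a, rfl⟩ _ ⟨b, rfl⟩
    rw [← dist_eq_norm]; exact hle a b
  -- directions of the edges, alternately reversed
  have hanti : ∀ {k : ℕ} {r : ℕ → V}, Odd k → (∀ i, r (i + k) = r i) →
      (-1 : ℝ) ^ k • (f (r (k + 1)) - f (r k)) = -((-1 : ℝ) ^ 0 • (f (r (0 + 1)) - f (r 0))) := by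
    intro k r hk hr
    have h0 := hr 0
    have h1 := hr 1
    rw [zero_add] at h0
    rw [add_comm] at h1
    rw [h0, h1, hk.neg_one_pow, neg_one_smul, pow_zero, one_smul]
  -- up to sign, two consecutive directions point away from the common endpoint of their edges
  have hcone : ∀ (r : ℕ → V) (i : ℕ) (α β : ℝ),
      α • ((-1 : ℝ) ^ i • (f (r (i + 1)) - f (r i))) +
        β • ((-1 : ℝ) ^ (i + 1) • (f (r (i + 1 + 1)) - f (r (i + 1)))) =
      (-1 : ℝ) ^ (i + 1) • (α • (f (r i) - f (r (i + 1))) +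
        β • (f (r (i + 1 + 1)) - f (r (i + 1)))) := by
    intro r i α β
    rw [pow_succ]
    module
  have hnorm : ∀ {a b : V}, G.Adj a b → ‖f a - f b‖ = D := fun h => by
    rw [← dist_eq_norm]; exact hG _ _ h
  obtain ⟨i, j, x, ⟨α, β, hα, hβ, hαβ, rfl⟩, γ, δ, t, hγ, hδ, hγδ, h⟩ :=
    exists_smul_add_smul_eq_of_antiperiodic
      (u := fun i => (-1 : ℝ) ^ i • (f (p (i + 1)) - f (p i)))
      (v := fun i => (-1 : ℝ) ^ i • (f (q (i + 1)) - f (q i))) (hanti hn hpn) (hanti hm hqm)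
      (by
        rintro i x ⟨α, β, hα, hβ, hαβ, rfl⟩
        rw [hcone]
        refine smul_ne_zero (pow_ne_zero _ (by norm_num)) (smul_add_smul_ne_zero hD
          (hnorm (hp i)) (hnorm (hp (i + 1)).symm) ?_ hα hβ (by linarith))
        rw [sub_sub_sub_cancel_right]
        exact hdiam _ ⟨_, rfl⟩ _ ⟨_, rfl⟩)
  rw [hcone, hcone, smul_smul] at h
  refine smul_add_smul_ne_of_diameters hD hdiam (x := f (p (i + 1))) (a := f (p i))
    (b := f (p (i + 1 + 1))) (y := f (q (j + 1))) (c := f (q j)) (d := f (q (j + 1 + 1))) ⟨_, rfl⟩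
    ⟨_, rfl⟩ ⟨_, rfl⟩ ⟨_, rfl⟩ ⟨_, rfl⟩ ⟨_, rfl⟩ (hnorm (hp i)) (hnorm (hp (i + 1)).symm)
    (hnorm (hq j)) (hnorm (hq (j + 1)).symm) (hne _ _) (hne _ _) (hne _ _).symm (hne _ _).symm
    hα hβ (by linarith) hγ hδ hγδ ((-1 : ℝ) ^ (j + 1) * (t * (-1 : ℝ) ^ (i + 1))) ?_
  rw [mul_smul, ← h, smul_smul, ← mul_pow]
  simp

end OddCycles

/-! ### Small triangle-free graphs -/

namespace SimpleGraph

variable {V : Type*} {G : SimpleGraph V}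

theorem exists_indep_subset_of_isBipartite_induce {S : Finset V} {k : ℕ}
    (h : (G.induce (S : Set V)).IsBipartite) (hk : 2 * k ≤ S.card + 1) :
    ∃ s ⊆ S, s.card = k ∧ ∀ a ∈ s, ∀ b ∈ s, ¬ G.Adj a b := by
  classical
  obtain ⟨C⟩ := h
  have key : ∀ t : Fin 2, k ≤ (S.attach.filter fun x : {x // x ∈ S} => C ⟨x, x.2⟩ = t).card →
      ∃ s ⊆ S, s.card = k ∧ ∀ a ∈ s, ∀ b ∈ s, ¬ G.Adj a b := by
    intro t ht
    obtain ⟨s, hs, hsk⟩ := Finset.exists_subset_card_eq ht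
    refine ⟨s.map (Function.Embedding.subtype _), ?_, by rw [Finset.card_map, hsk], ?_⟩
    · intro x hx
      obtain ⟨y, -, rfl⟩ := Finset.mem_map.1 hx
      exact y.2
    · intro a ha b hb hab
      obtain ⟨x, hx, rfl⟩ := Finset.mem_map.1 ha
      obtain ⟨y, hy, rfl⟩ := Finset.mem_map.1 hb
      have h1 := (Finset.mem_filter.1 (hs hx)).2
      have h2 := (Finset.mem_filter.1 (hs hy)).2
      have h3 : (G.induce (S : Set V)).Adj ⟨x, x.2⟩ ⟨y, y.2⟩ := hab
      exact C.valid h3 (h1.trans h2.symm)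
  have hsum := Finset.card_filter_add_card_filter_not (s := S.attach)
    (p := fun x : {x // x ∈ S} => C ⟨x, x.2⟩ = 0)
  have h1 : (S.attach.filter fun x : {x // x ∈ S} => ¬ C ⟨x, x.2⟩ = 0) =
      S.attach.filter fun x : {x // x ∈ S} => C ⟨x, x.2⟩ = 1 :=
    Finset.filter_congr fun x _ => by generalize C ⟨x, x.2⟩ = t; omega
  rw [h1, Finset.card_attach] at hsum
  by_cases h0 : k ≤ (S.attach.filter fun x : {x // x ∈ S} => C ⟨x, x.2⟩ = 0).card
  · exact key 0 h0
  · exact key 1 (by omega)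

theorem not_isBipartite_induce_of_triangle {S : Set V} {a b c : V} (ha : a ∈ S) (hb : b ∈ S)
    (hc : c ∈ S) (hab : G.Adj a b) (hac : G.Adj a c) (hbc : G.Adj b c) :
    ¬ (G.induce S).IsBipartite := by
  rintro ⟨C⟩
  have h1 := C.valid (show (G.induce S).Adj ⟨a, ha⟩ ⟨b, hb⟩ from hab)
  have h2 := C.valid (show (G.induce S).Adj ⟨a, ha⟩ ⟨c, hc⟩ from hac)
  have h3 := C.valid (show (G.induce S).Adj ⟨b, hb⟩ ⟨c, hc⟩ from hbc)
  omega

theorem not_isBipartite_induce_of_fiveCycle {S : Set V} {a b c d e : V} (ha : a ∈ S) (hb : b ∈ S)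
    (hc : c ∈ S) (hd : d ∈ S) (he : e ∈ S) (hab : G.Adj a b) (hbc : G.Adj b c) (hcd : G.Adj c d)
    (hde : G.Adj d e) (hea : G.Adj e a) :
    ¬ (G.induce S).IsBipartite := by
  rintro ⟨C⟩
  have h1 := C.valid (show (G.induce S).Adj ⟨a, ha⟩ ⟨b, hb⟩ from hab)
  have h2 := C.valid (show (G.induce S).Adj ⟨b, hb⟩ ⟨c, hc⟩ from hbc)
  have h3 := C.valid (show (G.induce S).Adj ⟨c, hc⟩ ⟨d, hd⟩ from hcd)
  have h4 := C.valid (show (G.induce S).Adj ⟨d, hd⟩ ⟨e, he⟩ from hde)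
  have h5 := C.valid (show (G.induce S).Adj ⟨e, he⟩ ⟨a, ha⟩ from hea)
  omega

/-- The Ramsey number `R(3, 3)` is at most `6`. -/
theorem exists_indep_three_of_six_le_card {S : Finset V}
    (hT : ∀ a b c, G.Adj a b → G.Adj a c → ¬ G.Adj b c) (hS : 6 ≤ S.card) :
    ∃ s ⊆ S, s.card = 3 ∧ ∀ a ∈ s, ∀ b ∈ s, ¬ G.Adj a b := by
  classical
  obtain ⟨v, hv⟩ : S.Nonempty := Finset.card_pos.1 (by omega)
  have h1 := Finset.card_erase_of_mem hv
  have h2 := Finset.card_filter_add_card_filter_not (s := S.erase v) (p := fun x => G.Adj v x)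
  by_cases h3 : 3 ≤ ((S.erase v).filter fun x => G.Adj v x).card
  · obtain ⟨s, hs, hs3⟩ := Finset.exists_subset_card_eq h3
    refine ⟨s, fun x hx => ?_, hs3, fun a ha b hb => ?_⟩
    · exact Finset.mem_of_mem_erase (Finset.mem_filter.1 (hs hx)).1
    · exact hT v a b (Finset.mem_filter.1 (hs ha)).2 (Finset.mem_filter.1 (hs hb)).2
  · obtain ⟨x, y, z, hx, hy, hz, hxy, hxz, hyz⟩ :=
      Finset.two_lt_card_iff.1 (show 2 < ((S.erase v).filter fun x => ¬ G.Adj v x).card by omega)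
    simp only [Finset.mem_filter, Finset.mem_erase] at hx hy hz
    have h4 : ∀ p q, p ≠ v → q ≠ v → p ≠ q → p ∈ S → q ∈ S → ¬ G.Adj v p → ¬ G.Adj v q →
        ¬ G.Adj p q → ∃ s ⊆ S, s.card = 3 ∧ ∀ a ∈ s, ∀ b ∈ s, ¬ G.Adj a b := by
      intro p q hpv hqv hpq hp hq hvp hvq hadj
      refine ⟨{v, p, q}, by grind, Finset.card_eq_three.2 ⟨v, p, q, hpv.symm, hqv.symm, hpq, rfl⟩,
        ?_⟩
      have h5 : ¬ G.Adj p v := fun h => hvp h.symm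
      have h6 : ¬ G.Adj q v := fun h => hvq h.symm
      have h7 : ¬ G.Adj q p := fun h => hadj h.symm
      simp [h5, h6, h7, hvp, hvq, hadj]
    by_cases hxy' : G.Adj x y
    · by_cases hxz' : G.Adj x z
      · exact h4 y z hy.1.1 hz.1.1 hyz hy.1.2 hz.1.2 hy.2 hz.2 (hT x y z hxy' hxz')
      · exact h4 x z hx.1.1 hz.1.1 hxz hx.1.2 hz.1.2 hx.2 hz.2 hxz'
    · exact h4 x y hx.1.1 hy.1.1 hxy hx.1.2 hy.1.2 hx.2 hy.2 hxy'

theorem length_le_card_of_nodup {H : Finset V} {l : List V} (hl : l.Nodup) (h : ∀ x ∈ l, x ∈ H) :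
    l.length ≤ H.card := by
  classical
  rw [← List.toFinset_card_of_nodup hl]
  exact Finset.card_le_card fun x hx => h x (List.mem_toFinset.1 hx)

open Classical in
/-- A `2`-regular triangle-free graph on seven vertices is a seven-cycle. -/
theorem exists_sevenCycle {H : Finset V} (hH : H.card = 7)
    (hT : ∀ a b c, G.Adj a b → G.Adj a c → ¬ G.Adj b c)
    (h2 : ∀ z ∈ H, (H.filter fun x => G.Adj z x).card = 2) :
    ∃ c : Fin 7 → V, Function.Injective c ∧ (∀ k, c k ∈ H) ∧ ∀ k, G.Adj (c k) (c (k + 1)) := by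
  have other : ∀ z ∈ H, ∀ p ∈ H, G.Adj z p →
      ∃ q ∈ H, q ≠ p ∧ G.Adj z q ∧ ∀ y ∈ H, G.Adj z y → y = p ∨ y = q := by
    intro z hz p hp hzp
    obtain ⟨x, y, hxy, hs⟩ := Finset.card_eq_two.1 (h2 z hz)
    have hmem : ∀ t, t ∈ H ∧ G.Adj z t ↔ t = x ∨ t = y := fun t => by
      rw [← Finset.mem_filter, hs]; simp
    have := hmem p
    have := hmem x
    have := hmem y
    grind
  have fresh : ∀ l : List V, l.length < 7 → ∃ r ∈ H, r ∉ l := by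
    intro l hl
    by_contra! hcon
    have h1 : H.card ≤ l.toFinset.card :=
      Finset.card_le_card fun x hx => List.mem_toFinset.2 (hcon x hx)
    have := l.toFinset_card_le
    omega
  have eight : ∀ l : List V, l.Nodup → (∀ x ∈ l, x ∈ H) → l.length ≠ 8 := by
    intro l hl h h8
    have := length_le_card_of_nodup hl h
    omega
  have two : ∀ z ∈ H, ∃ p ∈ H, ∃ q ∈ H, q ≠ p ∧ G.Adj z p ∧ G.Adj z q ∧
      ∀ y ∈ H, G.Adj z y → y = p ∨ y = q := by
    intro z hz
    obtain ⟨p, hp⟩ := Finset.card_pos.1 (show 0 < (H.filter fun x => G.Adj z x).card by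
      rw [h2 z hz]; norm_num)
    rw [Finset.mem_filter] at hp
    obtain ⟨q, hq⟩ := other z hz p hp.1 hp.2
    exact ⟨p, hp.1, q, hq.1, hq.2.1, hp.2, hq.2.2⟩
  have hsymm : ∀ x y, G.Adj x y → G.Adj y x := fun x y h => h.symm
  have hirr : ∀ x, ¬ G.Adj x x := fun x => G.loopless.irrefl x
  obtain ⟨w, hw, -⟩ := fresh [] (by simp)
  obtain ⟨a, ha, b, hb, hba, hwa, hwb, hwN⟩ := two w hw
  obtain ⟨a', ha', haw, haa', haN⟩ := other a ha w hw hwa.symm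
  obtain ⟨b', hb', hbw, hbb', hbN⟩ := other b hb w hw hwb.symm
  obtain ⟨r, hr, hra, har, harN⟩ := other a' ha' a ha haa'.symm
  obtain ⟨s, hs, hsb, hbs, hbsN⟩ := other b' hb' b hb hbb'.symm
  have hab' : ¬ G.Adj a b := hT w a b hwa hwb
  have h1 : a' ≠ b' := by
    rintro rfl
    -- the vertices `w`, `a`, `b`, `a'` form a component, and any other vertex `x` lies with
    -- three more outside it
    obtain ⟨x, hx, hxl⟩ := fresh [w, a, b, a'] (by simp)
    obtain ⟨p, hp, q, hq, hqp, hxp, hxq, hxN⟩ := two x hx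
    obtain ⟨t, ht, htx, hpt, hpN⟩ := other p hp x hx hxp.symm
    have := hT x p q hxp hxq
    have hnd : [w, a, b, a', x, p, q, t].Nodup := by
      clear other two fresh eight hT h2 hH
      simp only [List.nodup_cons, List.mem_cons, List.not_mem_nil, or_false, not_or,
        not_false_eq_true, List.nodup_nil, and_true] at hxl ⊢
      grind (splits := 60)
    exact eight _ hnd (by simp [*]) rfl
  have h3 : r ≠ b' := by
    rintro rfl
    obtain ⟨x, hx, hxl⟩ := fresh [w, a, b, a', r] (by simp)
    obtain ⟨p, hp, q, hq, hqp, hxp, hxq, hxN⟩ := two x hx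
    have hnd : [w, a, b, a', r, x, p, q].Nodup := by
      clear other two fresh eight hT h2 hH
      simp only [List.nodup_cons, List.mem_cons, List.not_mem_nil, or_false, not_or,
        not_false_eq_true, List.nodup_nil, and_true] at hxl ⊢
      grind (splits := 60)
    exact eight _ hnd (by simp [*]) rfl
  have h4 : r ≠ s := by
    rintro rfl
    obtain ⟨x, hx, hxl⟩ := fresh [w, a, b, a', b', r] (by simp)
    obtain ⟨p, hp, q, hq, hqp, hxp, hxq, hxN⟩ := two x hx
    obtain ⟨t, ht, htx, hrt, hrN⟩ := other r hr a' ha' har.symm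
    have hnd : [w, a, b, a', b', r, x, p].Nodup := by
      clear other two fresh eight hT h2 hH
      simp only [List.nodup_cons, List.mem_cons, List.not_mem_nil, or_false, not_or,
        not_false_eq_true, List.nodup_nil, and_true] at hxl ⊢
      grind (splits := 60)
    exact eight _ hnd (by simp [*]) rfl
  have hnd : [w, a, a', r, s, b', b].Nodup := by
    clear other two fresh eight hT h2 hH
    simp only [List.nodup_cons, List.mem_cons, List.not_mem_nil, or_false, not_or,
      not_false_eq_true, List.nodup_nil, and_true]
    grind (splits := 60)
  have h5 : G.Adj r s := by
    obtain ⟨t, ht, hta, hrt, hrN⟩ := other r hr a' ha' har.symm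
    by_contra hrs
    have hnd : [t, w, a, a', r, s, b', b].Nodup := by
      rw [List.nodup_cons]
      refine ⟨?_, hnd⟩
      clear other two fresh eight hT h2 hH
      simp only [List.nodup_cons, List.mem_cons, List.not_mem_nil, or_false, not_or,
        not_false_eq_true, List.nodup_nil, and_true] at hnd ⊢
      grind (splits := 60)
    exact eight _ hnd (by simp [*]) rfl
  refine ⟨[w, a, a', r, s, b', b].get, List.nodup_iff_injective_get.1 hnd, ?_, ?_⟩
  · intro k
    fin_cases k <;> assumption
  · intro k
    fin_cases k
    exacts [hwa, haa', har, h5, hbs.symm, hbb'.symm, hwb.symm]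

theorem forall_mem_four {P : V → Prop} {a b c d : V} (ha : P a) (hb : P b) (hc : P c) (hd : P d) :
    ∀ x ∈ [a, b, c, d], P x := by
  simp [ha, hb, hc, hd]

theorem forall_mem_seven {P : V → Prop} {a b c d e f g : V} (ha : P a) (hb : P b) (hc : P c)
    (hd : P d) (he : P e) (hf : P f) (hg : P g) : ∀ x ∈ [a, b, c, d, e, f, g], P x := by
  simp [ha, hb, hc, hd, he, hf, hg]

/-- Let `x`, `y`, `z` be the neighbours of `w`, and `p`, `q`, `r` the other vertices of `H`, with
`p` and `q` adjacent. A perfect matching between the two triples would give a five-cycle through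
`w` and `pq` disjoint from the third edge of the matching. If `r` shares its neighbour `x` with
`p`, the lack of such a matching makes `y`, `z`, `p`, `r` independent. -/
theorem false_of_adj_outer_of_adj {H : Finset V}
    (hT : ∀ a b c, G.Adj a b → G.Adj a c → ¬ G.Adj b c)
    (hα : ∀ x y z t, (∀ v ∈ [x, y, z, t], v ∈ H) → [x, y, z, t].Nodup →
      G.Adj x y ∨ G.Adj x z ∨ G.Adj x t ∨ G.Adj y z ∨ G.Adj y t ∨ G.Adj z t)
    (hC : ∀ x y a b c d e, (∀ z ∈ [x, y, a, b, c, d, e], z ∈ H) → [x, y, a, b, c, d, e].Nodup →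
      G.Adj x y → G.Adj a b → G.Adj b c → G.Adj c d → G.Adj d e → ¬ G.Adj e a)
    {w x y z p q r : V} (hH : ∀ t ∈ [w, x, y, z, p, q, r], t ∈ H)
    (hxy : x ≠ y) (hxz : x ≠ z) (hyz : y ≠ z) (hpq : p ≠ q) (hpr : p ≠ r) (hqr : q ≠ r)
    (hp : p ≠ w ∧ ¬ G.Adj w p) (hq : q ≠ w ∧ ¬ G.Adj w q) (hr : r ≠ w ∧ ¬ G.Adj w r)
    (hwx : G.Adj w x) (hwy : G.Adj w y) (hwz : G.Adj w z) (hadj : G.Adj p q)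
    (hxp : G.Adj x p) (hyq : G.Adj y q) (hxr : G.Adj x r)
    (hz : G.Adj z p ∨ G.Adj z q ∨ G.Adj z r) : False := by
  have hne : ∀ s t, G.Adj w s → ¬ G.Adj w t → s ≠ t := fun s t h h' hst => h' (hst ▸ h)
  simp only [List.mem_cons, List.not_mem_nil, or_false, forall_eq_or_imp, forall_eq] at hH
  obtain ⟨mw, mx, my, mz, mp, mq, mr⟩ := hH
  -- there is no perfect matching between `x`, `y`, `z` and `p`, `q`, `r`
  have hmatch : ∀ a b c, a ≠ b → a ≠ c → b ≠ c → a ∈ H → b ∈ H → c ∈ H →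
      G.Adj w a → G.Adj w b → G.Adj w c → G.Adj a p → G.Adj b q → ¬ G.Adj c r := by
    intro a b c hab hac hbc ha hb hc hwa hwb hwc hap hbq hcr
    refine hC r c w a p q b (forall_mem_seven mr hc mw ha mp mq hb) ?_ hcr.symm hwa hap
      hadj hbq.symm hwb.symm
    have n1 := hne a p hwa hp.2
    have n2 := hne a q hwa hq.2
    have n3 := hne a r hwa hr.2
    have n4 := hne b p hwb hp.2
    have n5 := hne b q hwb hq.2
    have n6 := hne b r hwb hr.2
    have n7 := hne c p hwc hp.2
    have n8 := hne c q hwc hq.2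
    have n9 := hne c r hwc hr.2
    simp only [List.nodup_cons, List.mem_cons, List.not_mem_nil, or_false, not_or,
      not_false_eq_true, List.nodup_nil, and_true]
    exact ⟨⟨n9.symm, hr.1, n3.symm, hpr.symm, hqr.symm, n6.symm⟩,
      ⟨hwc.ne', hac.symm, n7, n8, hbc.symm⟩, ⟨hwa.ne, hp.1.symm, hq.1.symm, hwb.ne⟩,
      ⟨n1, n2, hab⟩, ⟨hpq, n4.symm⟩, n5.symm⟩
  have h1 := hmatch x y z hxy hxz hyz mx my mz hwx hwy hwz hxp hyq
  have h2 : ¬ G.Adj z p := fun h =>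
    hmatch z y x hyz.symm hxz.symm hxy.symm mz my mx hwz hwy hwx h hyq hxr
  have h3 : G.Adj z q := by tauto
  have h4 := hmatch x z y hxz hxy hyz.symm mx mz my hwx hwz hwy hxp h3
  have h5 : ¬ G.Adj y p := fun h => hT y p q h hyq hadj
  have h6 := hα y z p r (forall_mem_four my mz mp mr) (by
    simp only [List.nodup_cons, List.mem_cons, List.not_mem_nil, or_false, not_or,
      not_false_eq_true, List.nodup_nil, and_true]
    exact ⟨⟨hyz, hne y p hwy hp.2, hne y r hwy hr.2⟩, ⟨hne z p hwz hp.2, hne z r hwz hr.2⟩, hpr⟩)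
  have h7 := hT w y z hwy hwz
  have h8 := hT x p r hxp hxr
  tauto

/-- In a triangle-free graph on seven vertices without four independent vertices and without an edge
disjoint from a five-cycle, the vertices not adjacent to a vertex `w` of degree three are pairwise
non-adjacent. (With `w` they would then be independent.) -/
theorem not_adj_outer_of_degree_three {H : Finset V}
    (hT : ∀ a b c, G.Adj a b → G.Adj a c → ¬ G.Adj b c)
    (hα : ∀ x y z t, (∀ v ∈ [x, y, z, t], v ∈ H) → [x, y, z, t].Nodup →
      G.Adj x y ∨ G.Adj x z ∨ G.Adj x t ∨ G.Adj y z ∨ G.Adj y t ∨ G.Adj z t)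
    (hC : ∀ x y a b c d e, (∀ z ∈ [x, y, a, b, c, d, e], z ∈ H) → [x, y, a, b, c, d, e].Nodup →
      G.Adj x y → G.Adj a b → G.Adj b c → G.Adj c d → G.Adj d e → ¬ G.Adj e a)
    {w a b c p q r : V} (hH : ∀ t ∈ [w, a, b, c, p, q, r], t ∈ H)
    (hab : a ≠ b) (hac : a ≠ c) (hbc : b ≠ c) (hpq : p ≠ q) (hpr : p ≠ r) (hqr : q ≠ r)
    (hp : p ≠ w ∧ ¬ G.Adj w p) (hq : q ≠ w ∧ ¬ G.Adj w q) (hr : r ≠ w ∧ ¬ G.Adj w r)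
    (hwa : G.Adj w a) (hwb : G.Adj w b) (hwc : G.Adj w c)
    (ha : G.Adj a p ∨ G.Adj a q ∨ G.Adj a r) (hb : G.Adj b p ∨ G.Adj b q ∨ G.Adj b r)
    (hc : G.Adj c p ∨ G.Adj c q ∨ G.Adj c r) :
    ¬ G.Adj p q := by
  intro hadj
  have hne : ∀ s t, G.Adj w s → ¬ G.Adj w t → s ≠ t := fun s t h h' hst => h' (hst ▸ h)
  have hH' := hH
  simp only [List.mem_cons, List.not_mem_nil, or_false, forall_eq_or_imp, forall_eq] at hH'
  obtain ⟨mw, ma, mb, mc, mp, mq, mr⟩ := hH'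
  have nab := hT w a b hwa hwb
  have nac := hT w a c hwa hwc
  have nbc := hT w b c hwb hwc
  -- every outer vertex has a neighbour among `a`, `b`, `c`
  have outer : ∀ t, t ∈ H → ¬ G.Adj w t → G.Adj a t ∨ G.Adj b t ∨ G.Adj c t := by
    intro t ht hwt
    have := hα a b c t (forall_mem_four ma mb mc ht) (by
      simp only [List.nodup_cons, List.mem_cons, List.not_mem_nil, or_false, not_or,
        not_false_eq_true, List.nodup_nil, and_true]
      exact ⟨⟨hab, hac, hne a t hwa hwt⟩, ⟨hbc, hne b t hwb hwt⟩, hne c t hwc hwt⟩)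
    rcases this with h | h | h | h | h | h
    exacts [absurd h nab, absurd h nac, Or.inl h, absurd h nbc, Or.inr (Or.inl h),
      Or.inr (Or.inr h)]
  have step : ∀ x y z, x ∈ H → y ∈ H → z ∈ H → x ≠ y → x ≠ z → y ≠ z → G.Adj w x → G.Adj w y →
      G.Adj w z → (G.Adj x p ∨ G.Adj x q ∨ G.Adj x r) → (G.Adj y p ∨ G.Adj y q ∨ G.Adj y r) →
      (G.Adj z p ∨ G.Adj z q ∨ G.Adj z r) → (G.Adj x r ∨ G.Adj y r ∨ G.Adj z r) →
      G.Adj x p → ¬ G.Adj y q := by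
    intro x y z mx my mz hxy hxz hyz hwx hwy hwz hx hy hz hr' hxp hyq
    have key := @false_of_adj_outer_of_adj V G H hT hα hC w
    rcases hr' with h | h | h
    · exact key (forall_mem_seven mw mx my mz mp mq mr) hxy hxz hyz hpq hpr hqr hp hq hr
        hwx hwy hwz hadj hxp hyq h hz
    · exact key (forall_mem_seven mw my mx mz mq mp mr) hxy.symm hyz hxz hpq.symm hqr hpr
        hq hp hr hwy hwx hwz hadj.symm hyq hxp h (or_left_comm.1 hz)
    · -- the outer vertex `r` is matched with `z`, which leaves a five-cycle
      refine hC r z w x p q y (forall_mem_seven mr mz mw mx mp mq my) ?_ h.symm hwx hxp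
        hadj hyq.symm hwy.symm
      simp only [List.nodup_cons, List.mem_cons, List.not_mem_nil, or_false, not_or,
        not_false_eq_true, List.nodup_nil, and_true]
      exact ⟨⟨(hne z r hwz hr.2).symm, hr.1, (hne x r hwx hr.2).symm, hpr.symm, hqr.symm,
        (hne y r hwy hr.2).symm⟩, ⟨hwz.ne', hxz.symm, hne z p hwz hp.2, hne z q hwz hq.2, hyz.symm⟩,
        ⟨hwx.ne, hp.1.symm, hq.1.symm, hwy.ne⟩, ⟨hne x p hwx hp.2, hne x q hwx hq.2, hxy⟩,
        ⟨hpq, (hne y p hwy hp.2).symm⟩, (hne y q hwy hq.2).symm⟩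
  have op := outer p mp hp.2
  have oq := outer q mq hq.2
  have or' := outer r mr hr.2
  have s1 := step a b c ma mb mc hab hac hbc hwa hwb hwc ha hb hc or'
  have s2 := step a c b ma mc mb hac hab hbc.symm hwa hwc hwb ha hc hb (or'.imp_right Or.symm)
  have s3 := step b a c mb ma mc hab.symm hbc hac hwb hwa hwc hb ha hc (or_left_comm.1 or')
  have s4 := step b c a mb mc ma hbc hab.symm hac.symm hwb hwc hwa hb hc ha (or_rotate.1 or')
  have s5 := step c a b mc ma mb hac.symm hbc.symm hab hwc hwa hwb hc ha hb
    (or_rotate.1 (or_rotate.1 or'))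
  have s6 := step c b a mc mb ma hbc.symm hac.symm hab.symm hwc hwb hwa hc hb ha
    (or_left_comm.1 (or_rotate.1 or'))
  rcases op with h | h | h <;> rcases oq with h' | h' | h'
  exacts [hT a p q h h' hadj, s1 h h', s2 h h', s3 h h', hT b p q h h' hadj, s4 h h', s5 h h',
    s6 h h', hT c p q h h' hadj]

open Classical in
theorem card_filter_adj_ne_three {H : Finset V} (hH : H.card = 7)
    (hT : ∀ a b c, G.Adj a b → G.Adj a c → ¬ G.Adj b c)
    (hα : ∀ x y z t, (∀ v ∈ [x, y, z, t], v ∈ H) → [x, y, z, t].Nodup →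
      G.Adj x y ∨ G.Adj x z ∨ G.Adj x t ∨ G.Adj y z ∨ G.Adj y t ∨ G.Adj z t)
    (hC : ∀ x y a b c d e, (∀ z ∈ [x, y, a, b, c, d, e], z ∈ H) → [x, y, a, b, c, d, e].Nodup →
      G.Adj x y → G.Adj a b → G.Adj b c → G.Adj c d → G.Adj d e → ¬ G.Adj e a)
    (h2 : ∀ z ∈ H, 2 ≤ (H.filter fun x => G.Adj z x).card) {w : V} (hw : w ∈ H) :
    (H.filter fun x => G.Adj w x).card ≠ 3 := by
  intro h3
  obtain ⟨a, b, c, hab, hac, hbc, hN⟩ := Finset.card_eq_three.1 h3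
  have hmem : ∀ t, t ∈ H ∧ G.Adj w t ↔ t = a ∨ t = b ∨ t = c := fun t => by
    rw [← Finset.mem_filter, hN]; simp
  obtain ⟨ha, hwa⟩ := (hmem a).2 (by simp)
  obtain ⟨hb, hwb⟩ := (hmem b).2 (by simp)
  obtain ⟨hc, hwc⟩ := (hmem c).2 (by simp)
  have hsub : ({w, a, b, c} : Finset V) ⊆ H := by
    intro x hx
    simp only [Finset.mem_insert, Finset.mem_singleton] at hx
    rcases hx with rfl | rfl | rfl | rfl <;> assumption
  have h4 : ({w, a, b, c} : Finset V).card = 4 := by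
    have := hwa.ne; have := hwb.ne; have := hwc.ne
    rw [Finset.card_eq_succ]
    exact ⟨w, {a, b, c}, by simp [*], rfl, Finset.card_eq_three.2 ⟨a, b, c, hab, hac, hbc, rfl⟩⟩
  have h5 : (H \ {w, a, b, c}).card = 3 := by
    rw [Finset.card_sdiff_of_subset hsub]; omega
  obtain ⟨p, q, r, hpq, hpr, hqr, hR⟩ := Finset.card_eq_three.1 h5
  have hmemR : ∀ t, t ∈ H ∧ ¬ (t = w ∨ t = a ∨ t = b ∨ t = c) ↔ t = p ∨ t = q ∨ t = r := fun t => by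
    have : t ∈ H \ {w, a, b, c} ↔ t ∈ ({p, q, r} : Finset V) := by rw [hR]
    simpa using this
  have outer : ∀ t, t ∈ H → G.Adj w t → G.Adj t p ∨ G.Adj t q ∨ G.Adj t r := by
    intro t ht hwt
    obtain ⟨x, hx, hxw⟩ := Finset.exists_mem_ne (show 1 < _ from h2 t ht) w
    rw [Finset.mem_filter] at hx
    have h6 : ¬ G.Adj w x := fun h => hT w t x hwt h hx.2
    have h7 := (hmemR x).1 ⟨hx.1, by rintro (rfl | rfl | rfl | rfl) <;> contradiction⟩
    rcases h7 with rfl | rfl | rfl <;> simp [hx.2]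
  have oa := outer a ha hwa
  have ob := outer b hb hwb
  have oc := outer c hc hwc
  obtain ⟨hp, hp'⟩ := (hmemR p).2 (by simp)
  obtain ⟨hq, hq'⟩ := (hmemR q).2 (by simp)
  obtain ⟨hr, hr'⟩ := (hmemR r).2 (by simp)
  simp only [not_or] at hp' hq' hr'
  have hmem' : ∀ x y z, x ∈ H → y ∈ H → z ∈ H → ∀ v ∈ [w, a, b, c, x, y, z], v ∈ H := by
    intro x y z hx hy hz
    exact forall_mem_seven hw ha hb hc hx hy hz
  have hwO : ∀ x, x ∈ H → ¬x = a → ¬x = b → ¬x = c → ¬ G.Adj w x := by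
    intro x hx h1 h2 h3 h
    have := (hmem x).1 ⟨hx, h⟩
    tauto
  have w1 : p ≠ w ∧ ¬ G.Adj w p := ⟨hp'.1, hwO p hp hp'.2.1 hp'.2.2.1 hp'.2.2.2⟩
  have w2 : q ≠ w ∧ ¬ G.Adj w q := ⟨hq'.1, hwO q hq hq'.2.1 hq'.2.2.1 hq'.2.2.2⟩
  have w3 : r ≠ w ∧ ¬ G.Adj w r := ⟨hr'.1, hwO r hr hr'.2.1 hr'.2.2.1 hr'.2.2.2⟩
  have key := @not_adj_outer_of_degree_three V G H hT hα hC w a b c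
  have k1 := key (hmem' p q r hp hq hr) hab hac hbc hpq hpr hqr w1 w2 w3 hwa hwb hwc oa ob oc
  have k2 := key (hmem' p r q hp hr hq) hab hac hbc hpr hpq hqr.symm w1 w3 w2 hwa hwb hwc
    (oa.imp_right Or.symm) (ob.imp_right Or.symm) (oc.imp_right Or.symm)
  have k3 := key (hmem' q r p hq hr hp) hab hac hbc hqr hpq.symm hpr.symm w2 w3 w1 hwa hwb hwc
    (or_rotate.1 oa) (or_rotate.1 ob) (or_rotate.1 oc)
  have := hα w p q r (forall_mem_four hw hp hq hr) (by
    simp only [List.nodup_cons, List.mem_cons, List.not_mem_nil, or_false, not_or,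
      not_false_eq_true, List.nodup_nil, and_true]
    exact ⟨⟨w1.1.symm, w2.1.symm, w3.1.symm⟩, ⟨hpq, hpr⟩, hqr⟩)
  rcases this with h | h | h | h | h | h
  exacts [w1.2 h, w2.2 h, w3.2 h, k1 h, k2 h, k3 h]

set_option maxRecDepth 20000 in
/-- An independent set of the seven-cycle misses two of the seven independent triples
`{k, k + 2, k + 4}`. -/
theorem exists_two_triples_avoided (f : Fin 7 → Bool) (h : ∀ k, ¬ (f k = true ∧ f (k + 1) = true)) :
    1 < (Finset.univ.filter fun k : Fin 7 => f k = false ∧ f (k + 2) = false ∧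
      f (k + 4) = false).card := by
  revert f
  decide

open Classical in
/-- Each of the four vertices in `N` misses two of the seven independent triples of the cycle, so
two of them miss the same triple. -/
theorem exists_indep_five_of_sevenCycle {N : Finset V} (hN : N.card = 4)
    (hNi : ∀ a ∈ N, ∀ b ∈ N, ¬ G.Adj a b)
    (hT : ∀ a b c, G.Adj a b → G.Adj a c → ¬ G.Adj b c) {c : Fin 7 → V}
    (hc : Function.Injective c) (hcN : ∀ k, c k ∉ N)
    (hadj : ∀ k l, G.Adj (c k) (c l) ↔ l = k + 1 ∨ k = l + 1) :
    ∃ s : Finset V, s.card = 5 ∧ ∀ a ∈ s, ∀ b ∈ s, ¬ G.Adj a b := by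
  set M : V → Finset (Fin 7) := fun i => Finset.univ.filter fun k : Fin 7 =>
    ¬ G.Adj i (c k) ∧ ¬ G.Adj i (c (k + 2)) ∧ ¬ G.Adj i (c (k + 4)) with hM
  have hM2 : ∀ i, 2 ≤ (M i).card := by
    intro i
    have := exists_two_triples_avoided (fun k => decide (G.Adj i (c k))) (by
      intro k
      simp only [decide_eq_true_eq]
      exact fun h => hT i _ _ h.1 h.2 ((hadj k (k + 1)).2 (Or.inl rfl)))
    exact Nat.succ_le_of_lt (by simpa [hM] using this)
  have hex : ∃ i ∈ N, ∃ j ∈ N, i ≠ j ∧ ¬ Disjoint (M i) (M j) := by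
    by_contra! hcon
    have h1 := Finset.card_biUnion (s := N) (t := M) fun i hi j hj hij => hcon i hi j hj hij
    have h2 : N.card * 2 ≤ ∑ i ∈ N, (M i).card := by
      rw [← smul_eq_mul]; exact Finset.card_nsmul_le_sum _ _ _ fun i _ => hM2 i
    have h3 := Finset.card_le_univ (N.biUnion M)
    rw [Fintype.card_fin] at h3
    omega
  obtain ⟨i, hi, j, hj, hij, hd⟩ := hex
  obtain ⟨k, hki, hkj⟩ := Finset.not_disjoint_iff.1 hd
  simp only [hM, Finset.mem_filter, Finset.mem_univ, true_and] at hki hkj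
  have hind : ∀ l ∈ ({k, k + 2, k + 4} : Finset (Fin 7)),
      ∀ l' ∈ ({k, k + 2, k + 4} : Finset (Fin 7)),
      ¬ (l' = l + 1 ∨ l = l' + 1) := by
    clear hki hkj
    revert k
    decide
  have h3 : ({k, k + 2, k + 4} : Finset (Fin 7)).card = 3 := by
    clear hki hkj hind
    revert k
    decide
  have hi' : ∀ l ∈ ({k, k + 2, k + 4} : Finset (Fin 7)), ¬ G.Adj i (c l) ∧ ¬ G.Adj j (c l) := by
    intro l hl
    simp only [Finset.mem_insert, Finset.mem_singleton] at hl
    rcases hl with rfl | rfl | rfl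
    exacts [⟨hki.1, hkj.1⟩, ⟨hki.2.1, hkj.2.1⟩, ⟨hki.2.2, hkj.2.2⟩]
  refine ⟨{i, j} ∪ ({k, k + 2, k + 4} : Finset (Fin 7)).image c, ?_, ?_⟩
  · rw [Finset.card_union_of_disjoint, Finset.card_image_of_injective _ hc, h3,
      Finset.card_pair hij]
    rw [Finset.disjoint_left]
    intro x hx hx'
    obtain ⟨l, -, rfl⟩ := Finset.mem_image.1 hx'
    simp only [Finset.mem_insert, Finset.mem_singleton] at hx
    rcases hx with hx | hx
    · exact hcN l (hx ▸ hi)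
    · exact hcN l (hx ▸ hj)
  · intro a ha b hb
    rw [Finset.mem_union, Finset.mem_insert, Finset.mem_singleton, Finset.mem_image] at ha hb
    rcases ha with ha | ⟨l, hl, rfl⟩ <;> rcases hb with hb | ⟨l', hl', rfl⟩
    · exact hNi a (by rcases ha with rfl | rfl <;> assumption) b
        (by rcases hb with rfl | rfl <;> assumption)
    · rcases ha with rfl | rfl
      · exact (hi' l' hl').1
      · exact (hi' l' hl').2
    · rw [G.adj_comm]
      rcases hb with rfl | rfl
      · exact (hi' l hl).1
      · exact (hi' l hl).2
    · rw [hadj]; exact hind l hl l' hl'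

/-! ### Independent sets in graphs on twelve vertices -/

section Twelve

variable [Fintype V]

/-- The vertices outside the closed neighbourhoods of `v` and `w`. -/
noncomputable def farSet (G : SimpleGraph V) (v w : V) : Finset V := by
  classical
  exact Finset.univ.filter fun x => x ≠ v ∧ x ≠ w ∧ ¬ G.Adj v x ∧ ¬ G.Adj w x

theorem mem_farSet {v w x : V} :
    x ∈ G.farSet v w ↔ x ≠ v ∧ x ≠ w ∧ ¬ G.Adj v x ∧ ¬ G.Adj w x := by
  simp [farSet]

open Classical in
theorem card_farSet {v w : V} (hvw : v ≠ w) (hadj : ¬ G.Adj v w) :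
    (G.farSet v w).card + 2 + (G.neighborFinset v).card + (G.neighborFinset w).card =
      Fintype.card V + (G.neighborFinset v ∩ G.neighborFinset w).card := by
  have h1 : (G.farSet v w)ᶜ = {v, w} ∪ (G.neighborFinset v ∪ G.neighborFinset w) := by
    ext x
    simp only [Finset.mem_compl, mem_farSet, Finset.mem_union, Finset.mem_insert,
      Finset.mem_singleton, mem_neighborFinset]
    tauto
  have h2 : Disjoint ({v, w} : Finset V) (G.neighborFinset v ∪ G.neighborFinset w) := by
    rw [Finset.disjoint_left]
    intro x hx
    simp only [Finset.mem_insert, Finset.mem_singleton] at hx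
    simp only [Finset.mem_union, mem_neighborFinset]
    rcases hx with rfl | rfl
    · exact fun h => h.elim G.irrefl fun h => hadj h.symm
    · exact fun h => h.elim hadj G.irrefl
  have h3 := Finset.card_union_of_disjoint h2
  rw [← h1, Finset.card_pair hvw] at h3
  have h4 := Finset.card_union_add_card_inter (G.neighborFinset v) (G.neighborFinset w)
  have h5 := Finset.card_add_card_compl (G.farSet v w)
  omega

theorem not_indep_three_farSet (hα : ∀ s : Finset V, s.card = 5 → ∃ a ∈ s, ∃ b ∈ s, G.Adj a b)
    {v w : V} (hvw : v ≠ w) (hadj : ¬ G.Adj v w) :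
    ¬ ∃ s ⊆ G.farSet v w, s.card = 3 ∧ ∀ a ∈ s, ∀ b ∈ s, ¬ G.Adj a b := by
  classical
  rintro ⟨s, hs, hs3, hsi⟩
  have hwv : ¬ G.Adj w v := fun h => hadj h.symm
  have h1 : ∀ x ∈ s, x ≠ v ∧ x ≠ w ∧ ¬ G.Adj v x ∧ ¬ G.Adj w x := fun x hx => mem_farSet.1 (hs hx)
  have h2 : Disjoint ({v, w} : Finset V) s := by
    rw [Finset.disjoint_left]
    intro x hx hxs
    simp only [Finset.mem_insert, Finset.mem_singleton] at hx
    have := h1 x hxs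
    tauto
  obtain ⟨a, ha, b, hb, hab⟩ := hα ({v, w} ∪ s) (by
    rw [Finset.card_union_of_disjoint h2, Finset.card_pair hvw, hs3])
  simp only [Finset.mem_union, Finset.mem_insert, Finset.mem_singleton] at ha hb
  rcases ha with (rfl | rfl) | ha <;> rcases hb with (rfl | rfl) | hb
  · exact hab.ne rfl
  · exact hadj hab
  · exact (h1 b hb).2.2.1 hab
  · exact hwv hab
  · exact hab.ne rfl
  · exact (h1 b hb).2.2.2 hab
  · exact (h1 a ha).2.2.1 hab.symm
  · exact (h1 a ha).2.2.2 hab.symm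
  · exact hsi a ha b hb hab

theorem card_farSet_le (hT : ∀ a b c, G.Adj a b → G.Adj a c → ¬ G.Adj b c)
    (hα : ∀ s : Finset V, s.card = 5 → ∃ a ∈ s, ∃ b ∈ s, G.Adj a b)
    {v w : V} (hvw : v ≠ w) (hadj : ¬ G.Adj v w) : (G.farSet v w).card ≤ 5 := by
  by_contra! h
  exact not_indep_three_farSet hα hvw hadj (exists_indep_three_of_six_le_card hT h)

/-- If five vertices are far from `v` and `w` they span an odd cycle, so that `v` and `w` are not
at distance two on a five-cycle. -/
theorem not_adj_of_card_farSet_eq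
    (hα : ∀ s : Finset V, s.card = 5 → ∃ a ∈ s, ∃ b ∈ s, G.Adj a b)
    (hbip : ∀ S T : Set V, Disjoint S T → (G.induce S).IsBipartite ∨ (G.induce T).IsBipartite)
    {v w i a j : V} (hvw : v ≠ w) (hadj : ¬ G.Adj v w) (h5 : (G.farSet v w).card = 5)
    (hvi : G.Adj v i) (hwi : G.Adj w i) (hwa : G.Adj w a) (hvj : G.Adj v j) : ¬ G.Adj a j := by
  intro haj
  rcases hbip (G.farSet v w) (G.farSet v w : Set V)ᶜ disjoint_compl_right with h | h
  · exact not_indep_three_farSet hα hvw hadj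
      (exists_indep_subset_of_isBipartite_induce h (by omega))
  · refine not_isBipartite_induce_of_fiveCycle (a := v) (b := i) (c := w) (d := a) (e := j)
      ?_ ?_ ?_ ?_ ?_ hvi hwi.symm hwa haj hvj.symm h
    all_goals
      simp only [Set.mem_compl_iff, Finset.mem_coe, mem_farSet]
      tauto

open Classical in
/-- Here the graph turns out to be cubic, and to have no cycles of length four or five. -/
theorem exists_indep_five_of_card_neighborFinset_le_three (hV : Fintype.card V = 12)
    (hT : ∀ a b c, G.Adj a b → G.Adj a c → ¬ G.Adj b c)
    (hbip : ∀ S T : Set V, Disjoint S T → (G.induce S).IsBipartite ∨ (G.induce T).IsBipartite)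
    (hdeg : ∀ v, (G.neighborFinset v).card ≤ 3) :
    ∃ s : Finset V, s.card = 5 ∧ ∀ a ∈ s, ∀ b ∈ s, ¬ G.Adj a b := by
  by_contra! hα
  have hcn : ∀ v w, v ≠ w → ¬ G.Adj v w →
      (G.neighborFinset v ∩ G.neighborFinset w).card + 5 ≤
        (G.neighborFinset v).card + (G.neighborFinset w).card := by
    intro v w hvw hadj
    have h1 := card_farSet hvw hadj
    have h2 := card_farSet_le hT hα hvw hadj
    omega
  have hdeg2 : ∀ v, 2 ≤ (G.neighborFinset v).card := by
    intro v
    obtain ⟨w, -, hw⟩ := Finset.exists_mem_notMem_of_card_lt_card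
      (s := insert v (G.neighborFinset v)) (t := Finset.univ) (by
        rw [Finset.card_univ, hV]
        have := Finset.card_insert_le v (G.neighborFinset v)
        have := hdeg v
        omega)
    rw [Finset.mem_insert, mem_neighborFinset, not_or] at hw
    have := hcn v w (Ne.symm hw.1) hw.2
    have := hdeg w
    omega
  -- two vertices with a common neighbour have degree three and no other common neighbour
  have hcommon : ∀ v w i, v ≠ w → G.Adj i v → G.Adj i w → ¬ G.Adj v w ∧
      (G.neighborFinset v).card = 3 ∧ (G.neighborFinset v ∩ G.neighborFinset w).card = 1 ∧
      (G.farSet v w).card = 5 := by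
    intro v w i hvw hiv hiw
    have hadj := hT i v w hiv hiw
    have h1 := hcn v w hvw hadj
    have h2 : 0 < (G.neighborFinset v ∩ G.neighborFinset w).card :=
      Finset.card_pos.2 ⟨i, by simp [hiv.symm, hiw.symm]⟩
    have h3 := hdeg v
    have h4 := hdeg w
    have h5 := card_farSet hvw hadj
    exact ⟨hadj, by omega, by omega, by omega⟩
  have hdeg3 : ∀ v, (G.neighborFinset v).card = 3 := by
    intro v
    obtain ⟨i, hi⟩ := Finset.card_pos.1 (show 0 < (G.neighborFinset v).card by
      have := hdeg2 v; omega)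
    rw [mem_neighborFinset] at hi
    obtain ⟨w, hw, hwv⟩ := Finset.exists_mem_ne (show 1 < (G.neighborFinset i).card from hdeg2 i) v
    rw [mem_neighborFinset] at hw
    exact (hcommon v w i hwv.symm hi.symm hw).2.1
  obtain ⟨v⟩ : Nonempty V := Fintype.card_pos_iff.1 (by omega)
  -- the six vertices at distance two from `v` are independent
  set U := (G.neighborFinset v).biUnion fun i => (G.neighborFinset i).erase v with hU
  have hmem : ∀ x, x ∈ U ↔ ∃ i, G.Adj v i ∧ x ≠ v ∧ G.Adj i x := fun x => by
    simp [hU]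
  have hUcard : U.card = 6 := by
    rw [hU, Finset.card_biUnion]
    · rw [Finset.sum_const_nat (m := 2), hdeg3]
      intro i hi
      rw [mem_neighborFinset] at hi
      rw [Finset.card_erase_of_mem (by rw [mem_neighborFinset]; exact hi.symm), hdeg3]
    · intro i hi j hj hij
      rw [Finset.mem_coe, mem_neighborFinset] at hi hj
      rw [Function.onFun, Finset.disjoint_left]
      intro x hx hx'
      rw [Finset.mem_erase, mem_neighborFinset] at hx hx'
      have h1 := (hcommon v x i hx.1.symm hi.symm hx.2).2.2.1
      have h2 : 1 < (G.neighborFinset v ∩ G.neighborFinset x).card :=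
        Finset.one_lt_card.2 ⟨i, by simp [hi, hx.2.symm], j, by simp [hj, hx'.2.symm], hij⟩
      omega
  obtain ⟨s, hsU, hs⟩ := Finset.exists_subset_card_eq (show 5 ≤ U.card by omega)
  obtain ⟨x, hx, y, hy, hxy⟩ := hα s hs
  obtain ⟨i, hvi, hxv, hix⟩ := (hmem x).1 (hsU hx)
  obtain ⟨j, hvj, hyv, hjy⟩ := (hmem y).1 (hsU hy)
  obtain ⟨h1, -, -, h2⟩ := hcommon v x i hxv.symm hvi.symm hix
  exact not_adj_of_card_farSet_eq hα hbip hxv.symm h1 h2 hvi hix.symm hxy hvj hjy.symm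

open Classical in
theorem exists_indep_five_of_card_neighborFinset_eq_four (hV : Fintype.card V = 12)
    (hT : ∀ a b c, G.Adj a b → G.Adj a c → ¬ G.Adj b c)
    (hbip : ∀ S T : Set V, Disjoint S T → (G.induce S).IsBipartite ∨ (G.induce T).IsBipartite)
    (hdeg : ∀ v, (G.neighborFinset v).card ≤ 4) {v : V} (hv : (G.neighborFinset v).card = 4) :
    ∃ s : Finset V, s.card = 5 ∧ ∀ a ∈ s, ∀ b ∈ s, ¬ G.Adj a b := by
  by_contra! hα
  set N := G.neighborFinset v with hN
  have hmemN : ∀ x, x ∈ N ↔ G.Adj v x := fun x => by rw [hN, mem_neighborFinset]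
  have hNi : ∀ a ∈ N, ∀ b ∈ N, ¬ G.Adj a b := fun a ha b hb =>
    hT v a b ((hmemN a).1 ha) ((hmemN b).1 hb)
  set H : Finset V := (insert v N)ᶜ with hHdef
  have hmemH : ∀ x, x ∈ H ↔ x ≠ v ∧ ¬ G.Adj v x := fun x => by
    rw [hHdef, Finset.mem_compl, Finset.mem_insert, hmemN, not_or]
  have hH : H.card = 7 := by
    rw [hHdef, Finset.card_compl, Finset.card_insert_of_notMem (by simp [hmemN]), hv, hV]
  -- `N` is a maximal independent set
  have hdom : ∀ w ∈ H, ∃ j, G.Adj v j ∧ G.Adj w j := by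
    intro w hw
    rw [hmemH] at hw
    by_contra! hcon
    obtain ⟨a, ha, b, hb, hab⟩ := hα (insert w N) (by
      rw [Finset.card_insert_of_notMem (by rw [hmemN]; exact hw.2), hv])
    rw [Finset.mem_insert] at ha hb
    rcases ha with rfl | ha <;> rcases hb with rfl | hb
    · exact hab.ne rfl
    · exact hcon b ((hmemN b).1 hb) hab
    · exact hcon a ((hmemN a).1 ha) hab.symm
    · exact hNi a ha b hb hab
  -- with `v`, four independent vertices of `H` would give five
  have hα4 : ∀ x y z t, (∀ v ∈ [x, y, z, t], v ∈ H) → [x, y, z, t].Nodup →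
      G.Adj x y ∨ G.Adj x z ∨ G.Adj x t ∨ G.Adj y z ∨ G.Adj y t ∨ G.Adj z t := by
    intro x y z t hmem hnd
    have hnd' : [v, x, y, z, t].Nodup :=
      List.nodup_cons.2 ⟨fun h => ((hmemH v).1 (hmem v h)).1 rfl, hnd⟩
    have hvl : ∀ u ∈ [x, y, z, t], ¬ G.Adj v u := fun u hu => ((hmemH u).1 (hmem u hu)).2
    obtain ⟨a, ha, b, hb, hab⟩ := hα [v, x, y, z, t].toFinset
      (by rw [List.toFinset_card_of_nodup hnd']; rfl)
    rw [List.mem_toFinset, List.mem_cons] at ha hb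
    rcases ha with rfl | ha
    · rcases hb with rfl | hb
      · exact absurd rfl hab.ne
      · exact absurd hab (hvl b hb)
    rcases hb with rfl | hb
    · exact absurd hab.symm (hvl a ha)
    have hba := hab.symm
    have hne := hab.ne
    simp only [List.mem_cons, List.not_mem_nil, or_false] at ha hb
    clear hnd hnd' hmem hvl
    rcases ha with rfl | rfl | rfl | rfl <;> rcases hb with rfl | rfl | rfl | rfl <;>
      first | exact absurd rfl hne | simp only [hab, hba, true_or, or_true]
  -- an edge `xy` of `H` extends to a five-cycle through `v` and two of its neighbours
  have hC : ∀ x y a b c d e, (∀ z ∈ [x, y, a, b, c, d, e], z ∈ H) →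
      [x, y, a, b, c, d, e].Nodup → G.Adj x y → G.Adj a b → G.Adj b c → G.Adj c d → G.Adj d e →
      ¬ G.Adj e a := by
    intro x y a b c d e hmem hnd hxy hab hbc hcd hde hea
    obtain ⟨i, hvi, hxi⟩ := hdom x (hmem x (by simp))
    obtain ⟨j, hvj, hyj⟩ := hdom y (hmem y (by simp))
    have hout : ∀ z ∈ [a, b, c, d, e], z ∈ ({v, i, x, y, j} : Set V)ᶜ := by
      intro z hz
      obtain ⟨h1, h2⟩ := (hmemH z).1 (hmem z (List.mem_cons_of_mem _ (List.mem_cons_of_mem _ hz)))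
      rw [List.nodup_cons, List.nodup_cons] at hnd
      simp only [Set.mem_compl_iff, Set.mem_insert_iff, Set.mem_singleton_iff]
      rintro (h | h | h | h | h)
      · exact h1 h
      · exact h2 (h ▸ hvi)
      · exact hnd.1 (h ▸ List.mem_cons_of_mem _ hz)
      · exact hnd.2.1 (h ▸ hz)
      · exact h2 (h ▸ hvj)
    rcases hbip {v, i, x, y, j} {v, i, x, y, j}ᶜ disjoint_compl_right with h | h
    · exact not_isBipartite_induce_of_fiveCycle (by simp) (by simp) (by simp) (by simp) (by simp)
        hvi hxi.symm hxy hyj hvj.symm h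
    · exact not_isBipartite_induce_of_fiveCycle (hout a (by simp)) (hout b (by simp))
        (hout c (by simp)) (hout d (by simp)) (hout e (by simp)) hab hbc hcd hde hea h
  have hsplit : ∀ w, (G.neighborFinset v ∩ G.neighborFinset w).card +
      (H.filter fun x => G.Adj w x).card = (G.neighborFinset w).card ∨ G.Adj v w := by
    intro w
    by_cases hvw : G.Adj v w
    · exact Or.inr hvw
    left
    rw [← Finset.card_union_of_disjoint]
    · congr 1
      ext x
      simp only [Finset.mem_union, Finset.mem_inter, mem_neighborFinset, Finset.mem_filter, hmemH]
      constructor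
      · tauto
      · intro h
        have : x ≠ v := by rintro rfl; exact hvw h.symm
        tauto
    · rw [Finset.disjoint_left]
      intro x hx hx'
      rw [Finset.mem_inter, mem_neighborFinset] at hx
      rw [Finset.mem_filter, hmemH] at hx'
      exact hx'.1.2 hx.1
  have hbound : ∀ w ∈ H, 2 ≤ (H.filter fun x => G.Adj w x).card ∧
      (H.filter fun x => G.Adj w x).card ≤ 3 := by
    intro w hw
    obtain ⟨hwv, hvw⟩ := (hmemH w).1 hw
    have h1 := (hsplit w).resolve_right hvw
    have h2 := card_farSet hwv.symm hvw
    have h3 := card_farSet_le hT hα hwv.symm hvw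
    have h4 := hdeg w
    have hv' : (G.neighborFinset v).card = 4 := hv
    obtain ⟨i, hvi, hwi⟩ := hdom w hw
    have h5 : 0 < (G.neighborFinset v ∩ G.neighborFinset w).card :=
      Finset.card_pos.2 ⟨i, by simp [hvi, hwi]⟩
    refine ⟨?_, by omega⟩
    by_contra! h6
    -- `w` has a single neighbour `a` in `H`, and exactly five vertices are far from `v` and `w`
    obtain ⟨a, ha⟩ := Finset.card_pos.1 (show 0 < (H.filter fun x => G.Adj w x).card by omega)
    rw [Finset.mem_filter] at ha
    obtain ⟨j, hvj, haj⟩ := hdom a ha.1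
    exact not_adj_of_card_farSet_eq hα hbip hwv.symm hvw (by omega) hvi hwi ha.2 hvj haj
  have h2 : ∀ w ∈ H, (H.filter fun x => G.Adj w x).card = 2 := by
    intro w hw
    have h1 := hbound w hw
    have h3 := card_filter_adj_ne_three hH hT hα4 hC (fun z hz => (hbound z hz).1) hw
    omega
  obtain ⟨c, hc, hcH, hcadj⟩ := exists_sevenCycle hH hT h2
  obtain ⟨s, hs, hsi⟩ := exists_indep_five_of_sevenCycle hv hNi hT hc
    (fun k hk => ((hmemH _).1 (hcH k)).2 ((hmemN _).1 hk)) (by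
      intro k l
      constructor
      · intro hkl
        by_contra! hcon
        have h3 : 2 < (H.filter fun x => G.Adj (c k) x).card := by
          refine Finset.two_lt_card.2 ⟨c (k + 1), ?_, c (k - 1), ?_, c l, ?_, ?_, ?_, ?_⟩
          · exact Finset.mem_filter.2 ⟨hcH _, hcadj k⟩
          · refine Finset.mem_filter.2 ⟨hcH _, ?_⟩
            have := (hcadj (k - 1)).symm
            rwa [sub_add_cancel] at this
          · exact Finset.mem_filter.2 ⟨hcH _, hkl⟩
          · intro h
            have := hc h
            clear hcon hkl h
            revert k
            decide
          · exact fun h => hcon.1 (hc h).symm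
          · exact fun h => hcon.2 (by rw [← hc h, sub_add_cancel])
        have := h2 _ (hcH k)
        omega
      · rintro (rfl | rfl)
        · exact hcadj k
        · exact (hcadj l).symm)
  obtain ⟨a, ha, b, hb, hab⟩ := hα s hs
  exact hsi a ha b hb hab

theorem exists_indep_five_of_disjoint_isBipartite (hV : Fintype.card V = 12)
    (hbip : ∀ S T : Set V, Disjoint S T → (G.induce S).IsBipartite ∨ (G.induce T).IsBipartite) :
    ∃ s : Finset V, s.card = 5 ∧ ∀ a ∈ s, ∀ b ∈ s, ¬ G.Adj a b := by
  classical
  by_contra! hα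
  have hT : ∀ a b c, G.Adj a b → G.Adj a c → ¬ G.Adj b c := by
    intro a b c hab hac hbc
    rcases hbip ({a, b, c} : Finset V) (({a, b, c}ᶜ : Finset V) : Set V) (by
      rw [Finset.coe_compl]; exact disjoint_compl_right) with h | h
    · exact not_isBipartite_induce_of_triangle (by simp) (by simp) (by simp) hab hac hbc h
    · have h3 : ({a, b, c} : Finset V).card = 3 :=
        Finset.card_eq_three.2 ⟨a, b, c, hab.ne, hac.ne, hbc.ne, rfl⟩
      obtain ⟨s, -, hs, hsi⟩ := exists_indep_subset_of_isBipartite_induce (k := 5) h (by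
        rw [Finset.card_compl, hV, h3])
      obtain ⟨x, hx, y, hy, hxy⟩ := hα s hs
      exact hsi x hx y hy hxy
  have hdeg : ∀ v, (G.neighborFinset v).card ≤ 4 := by
    intro v
    by_contra! h
    obtain ⟨s, hsN, hs⟩ := Finset.exists_subset_card_eq (show 5 ≤ (G.neighborFinset v).card from h)
    obtain ⟨x, hx, y, hy, hxy⟩ := hα s hs
    exact hT v x y ((G.mem_neighborFinset v x).1 (hsN hx))
      ((G.mem_neighborFinset v y).1 (hsN hy)) hxy
  by_cases h4 : ∃ v, (G.neighborFinset v).card = 4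
  · obtain ⟨v, hv⟩ := h4
    obtain ⟨s, hs, hsi⟩ := exists_indep_five_of_card_neighborFinset_eq_four hV hT hbip
      (by convert hdeg) (v := v) (by convert hv)
    obtain ⟨x, hx, y, hy, hxy⟩ := hα s hs
    exact hsi x hx y hy hxy
  · push Not at h4
    obtain ⟨s, hs, hsi⟩ := exists_indep_five_of_card_neighborFinset_le_three hV hT hbip
      (fun v => by
        have h1 := h4 v
        have h2 := hdeg v
        convert (show (G.neighborFinset v).card ≤ 3 by omega))
    obtain ⟨x, hx, y, hy, hxy⟩ := hα s hs
    exact hsi x hx y hy hxy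

end Twelve

end SimpleGraph

/-! ### Five points of a three-distance set -/

/-- For five equidistant points, the four difference vectors from one of them would be linearly
independent in `ℝ³`, as their Gram matrix is `r ^ 2 / 2 * (1 + J)` with `J` the all-ones matrix. -/
theorem card_le_four_of_equidistant {s : Finset (EuclideanSpace ℝ (Fin 3))} {r : ℝ} (hr : 0 < r)
    (h : ∀ P ∈ s, ∀ Q ∈ s, P ≠ Q → dist P Q = r) : s.card ≤ 4 := by
  by_contra! hs
  obtain ⟨f, hf⟩ : ∃ f : Fin 5 → EuclideanSpace ℝ (Fin 3),
      Function.Injective f ∧ ∀ i, f i ∈ s := by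
    obtain ⟨e⟩ := Function.Embedding.nonempty_of_card_le (α := Fin 5) (β := s) (by
      simpa using Nat.succ_le_of_lt hs)
    exact ⟨fun i => e i, Subtype.val_injective.comp e.injective, fun i => (e i).2⟩
  have hd : ∀ i j, i ≠ j → ‖f i - f j‖ = r := fun i j hij => by
    rw [← dist_eq_norm]; exact h _ (hf.2 i) _ (hf.2 j) (hf.1.ne hij)
  set v : Fin 4 → EuclideanSpace ℝ (Fin 3) := fun i => f i.succ - f 0 with hv
  have hvv : ∀ i, inner ℝ (v i) (v i) = r ^ 2 := fun i => by
    rw [real_inner_self_eq_norm_sq, hv, hd _ _ (Fin.succ_ne_zero i)]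
  have hvw : ∀ i j, i ≠ j → inner ℝ (v i) (v j) = r ^ 2 / 2 := fun i j hij => by
    have h1 := norm_sub_sq_real (v i) (v j)
    rw [← real_inner_self_eq_norm_sq (v i), ← real_inner_self_eq_norm_sq (v j), hvv, hvv, hv,
      sub_sub_sub_cancel_right, hd _ _ (fun h => hij (Fin.succ_injective _ h))] at h1
    simp only [hv]
    linarith
  have hli : LinearIndependent ℝ v := by
    rw [Fintype.linearIndependent_iff]
    intro g hg
    have h1 : ∀ j, g j + ∑ i, g i = 0 := by
      intro j
      have h2 : inner ℝ (∑ i, g i • v i) (v j) = r ^ 2 / 2 * (g j + ∑ i, g i) := by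
        rw [sum_inner]
        have h3 : ∀ i, inner ℝ (g i • v i) (v j) =
            r ^ 2 / 2 * g i + if i = j then r ^ 2 / 2 * g j else 0 := by
          intro i
          rw [real_inner_smul_left]
          split_ifs with hij
          · rw [hij, hvv]; ring
          · rw [hvw i j hij]; ring
        simp only [h3, Finset.sum_add_distrib, Finset.sum_ite_eq', Finset.mem_univ, if_true,
          ← Finset.mul_sum]
        ring
      rw [hg, inner_zero_left] at h2
      have : r ^ 2 / 2 ≠ 0 := by positivity
      exact (mul_eq_zero.1 h2.symm).resolve_left this
    have h2 : ∑ i, g i = 0 := by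
      have := Finset.sum_congr rfl fun j (_ : j ∈ (Finset.univ : Finset (Fin 4))) => h1 j
      rw [Finset.sum_add_distrib, Finset.sum_const, Finset.sum_const_zero] at this
      simp only [Finset.card_univ, Fintype.card_fin, nsmul_eq_mul] at this
      push_cast at this
      linarith
    intro i
    have := h1 i
    linarith
  have := hli.fintype_card_le_finrank
  simp at this

theorem two_le_encard_distanceSet {s : Finset (EuclideanSpace ℝ (Fin 3))} (hs : 5 ≤ s.card) :
    2 ≤ (distanceSet (s : Set (EuclideanSpace ℝ (Fin 3)))).encard := by
  by_contra! hlt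
  have h1 : (distanceSet (s : Set (EuclideanSpace ℝ (Fin 3)))).encard ≤ 1 :=
    Order.le_of_lt_add_one (by rwa [one_add_one_eq_two])
  rw [Set.encard_le_one_iff] at h1
  obtain ⟨P, hP, Q, hQ, hPQ⟩ := Finset.one_lt_card.1 (show 1 < s.card by omega)
  have := card_le_four_of_equidistant (s := s) (dist_pos.2 hPQ) fun P' hP' Q' hQ' hPQ' =>
    h1 _ _ ⟨P', hP', Q', hQ', hPQ', rfl⟩ ⟨P, hP, Q, hQ, hPQ, rfl⟩
  omega

theorem encard_distanceSet_le_of_avoids {X Y : Set (EuclideanSpace ℝ (Fin 3))} {k : ℕ}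
    (hX : IsKDistanceSet (k + 1) X) (hYX : Y ⊆ X) {D : ℝ} (hD : D ∈ distanceSet X)
    (hY : ∀ P ∈ Y, ∀ Q ∈ Y, dist P Q ≠ D) : (distanceSet Y).encard ≤ k := by
  have hsub : distanceSet Y ⊆ distanceSet X \ {D} := by
    rintro _ ⟨P, hP, Q, hQ, hPQ, rfl⟩
    exact ⟨⟨P, hYX hP, Q, hYX hQ, hPQ, rfl⟩, hY P hP Q hQ⟩
  have h := Set.encard_sdiff_singleton_add_one hD
  unfold IsKDistanceSet at hX
  rw [hX, Nat.cast_add, Nat.cast_one] at h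
  exact (Set.encard_le_encard hsub).trans (ENat.add_left_injective_of_ne_top ENat.one_ne_top h).le

/-- The graph on the points of `X` in which two points are joined when their distance is `D`. -/
def distanceGraph (X : Finset (EuclideanSpace ℝ (Fin 3))) (D : ℝ) : SimpleGraph X where
  Adj P Q := P ≠ Q ∧ dist (P : EuclideanSpace ℝ (Fin 3)) Q = D
  symm := ⟨fun P Q h => ⟨h.1.symm, by rw [dist_comm]; exact h.2⟩⟩
  loopless := ⟨fun P h => h.1 rfl⟩

theorem theorem1p4 (X : Finset (EuclideanSpace ℝ (Fin 3))) (hcard : X.card = 12)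
    (hX : IsKDistanceSet 3 (X : Set (EuclideanSpace ℝ (Fin 3)))) :
    ∃ Y : Finset (EuclideanSpace ℝ (Fin 3)), Y ⊆ X ∧ Y.card = 5 ∧
      IsKDistanceSet 2 (Y : Set (EuclideanSpace ℝ (Fin 3))) := by
  classical
  -- the diameter `D`, attained at a pair of distinct points
  obtain ⟨⟨A, B⟩, hAB, hmax⟩ := X.offDiag.exists_max_image (fun p => dist p.1 p.2) (by
    rw [← Finset.card_pos, Finset.offDiag_card, hcard]; norm_num)
  rw [Finset.mem_offDiag] at hAB
  obtain ⟨hA, hB, hne⟩ := hAB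
  set D := dist A B with hD
  have hD0 : 0 < D := dist_pos.2 hne
  have hle : ∀ P ∈ X, ∀ Q ∈ X, dist P Q ≤ D := by
    intro P hP Q hQ
    by_cases hPQ : P = Q
    · rw [hPQ, dist_self]; exact hD0.le
    · exact hmax (P, Q) (Finset.mem_offDiag.2 ⟨hP, hQ, hPQ⟩)
  have hbip : ∀ S T : Set X, Disjoint S T → ((distanceGraph X D).induce S).IsBipartite ∨
      ((distanceGraph X D).induce T).IsBipartite := fun S T hST =>
    isBipartite_induce_or_of_disjoint (G := distanceGraph X D)
      (f := fun P : X => (P : EuclideanSpace ℝ (Fin 3)))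
      Subtype.val_injective hD0 (fun a b => hle a a.2 b b.2) (fun a b h => h.2) hST
  have hcard' : Fintype.card X = 12 := by rw [Fintype.card_coe, hcard]
  obtain ⟨s, hs, hsi⟩ := SimpleGraph.exists_indep_five_of_disjoint_isBipartite hcard' hbip
  set Y := s.map (Function.Embedding.subtype _) with hY
  have hYX : Y ⊆ X := by
    intro P hP
    obtain ⟨Q, -, rfl⟩ := Finset.mem_map.1 hP
    exact Q.2
  have hY5 : Y.card = 5 := by rw [hY, Finset.card_map, hs]
  have hYD : ∀ P ∈ Y, ∀ Q ∈ Y, dist P Q ≠ D := by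
    intro P hP Q hQ
    obtain ⟨P, hP', rfl⟩ := Finset.mem_map.1 hP
    obtain ⟨Q, hQ', rfl⟩ := Finset.mem_map.1 hQ
    intro h
    refine hsi P hP' Q hQ' ⟨?_, h⟩
    rintro rfl
    rw [dist_self] at h
    exact hD0.ne h
  refine ⟨Y, hYX, hY5, le_antisymm ?_ (two_le_encard_distanceSet hY5.ge)⟩
  exact encard_distanceSet_le_of_avoids (k := 2) hX (Finset.coe_subset.2 hYX)
    ⟨A, hA, B, hB, hne, rfl⟩ hYD
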